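/- Let $\mathcal D$ be a triangulated category with Grothendieck group $K(\mathcal D)$; all subcategories are full and closed under isomorphism. A *stability condition* $\sigma=(Z,\mathcal P)$ on $\mathcal D$ is a homomorphism $Z\colon K(\mathcal D)\to\mathbb C$ together with full additive subcategories $\mathcal P(\phi)\subset\mathcal D$ ($\phi\in\mathbb R$) such that (a) if $0\ne E\in\mathcal P(\phi)$ then $Z(E)\in\mathbb R_{>0}\exp(i\pi\phi)$; (b) $\mathcal P(\phi+1)=\mathcal P(\phi)[1]$ for all $\phi$; (c) $\operatorname{Hom}(A_1,A_2)=0$ if $A_j\in\mathcal P(\phi_j)$ and $\phi_1>\phi_2$; (d) for every $0\neq E\in\mathcal D$ there are real numbers $\phi_1>\dots>\phi_n$ and distinguished triangles $E_{j-1}\to E_j\to A_j\to E_{j-1}[1]$, $1\le j\le n$, with $E_0=0$, $E_n=E$ and $A_j\in\mathcal P(\phi_j)$. For $I\subset\mathbb R$, $\mathcal P(I)$ is the extension-closed subcategory generated by the $\mathcal P(\phi)$ with $\phi\in I$. A *stability function* on an abelian category $\mathcal A$ is a homomorphism $Z\colon K(\mathcal A)\to\mathbb C$ such that for every $0\ne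 E\in\mathcal A$ one has $Z(E)\in\mathbb R_{>0}\exp(i\pi\phi(E))$ with $0<\phi(E)\le 1$; the number $\phi(E)$ is the phase of $E$. A nonzero object $E$ is *semistable* if $\phi(A)\le\phi(E)$ for every nonzero subobject $A\subset E$. $Z$ has the *Harder–Narasimhan property* if every nonzero $E\in\mathcal A$ has a finite filtration $0=E_0\subset E_1\subset\dots\subset E_n=E$ whose factors $F_j=E_j/E_{j-1}$ are semistable with $\phi(F_1)>\dots>\phi(F_n)$. A t-structure on $\mathcal D$ is *bounded* if every object $X$ of $\mathcal D$ satisfies $X\in\mathcal D^{\ge a}\cap\mathcal D^{\le b}$ for some integers $a,b$. Its heart is an abelian category. **Proposition.** (1) For every bounded t-structure on $\mathcal D$ with heart $\mathcal A$, the inclusion $\mathcal A\subset\mathcal D$ induces an isomorphism $K(\mathcal A)\cong K(\mathcal D)$, $[E]\mapsto[E]$. (2) There is a bijection between the stability conditions on $\mathcal D$ and the pairs consisting of a bounded t-structure on $\mathcal D$ and a stability function on its heart with the Harder–Narasimhan property, with the following description. - The pair corresponding to a stability condition $\sigma=(Z,\mathcal P)$ has heart $\mathcal A=\mathcal P((0,1])$,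 and its stability function is $[E]\mapsto Z(E)$ for $E\in\mathcal A$. - The stability condition $(Z',\mathcal P)$ corresponding to a bounded t-structure with heart $\mathcal A$ and a stability function $Z$ on $\mathcal A$ satisfies $Z'(E)=Z(E)$ for $E\in\mathcal A$; for $\phi\in(0,1]$, $\mathcal P(\phi)$ consists of the zero objects and the semistable objects of $\mathcal A$ of phase $\phi$; and $\mathcal P(\phi+n)=\mathcal P(\phi)[n]$ for $\phi\in(0,1]$ and $n\in\mathbb Z$. -/

import Mathlib

open CategoryTheory CategoryTheory.Limits CategoryTheory.Pretriangulated
open CategoryTheory.Triangulated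

universe v u

namespace BridgelandStability

/-! ### Grothendieck groups -/

section Grothendieck

/-- The Grothendieck group of a (pre)triangulated category: generators are the objects, with a
relation `[Y] = [X] + [Z]` for every distinguished triangle `X ⟶ Y ⟶ Z ⟶ X⟦1⟧`. -/
abbrev TriK₀ (D : Type u) [Category.{v} D] [Preadditive D] [HasZeroObject D] [HasShift D ℤ]
    [∀ n : ℤ, (shiftFunctor D n).Additive] [Pretriangulated D] : Type u :=
  FreeAbelianGroup D ⧸ AddSubgroup.closure
    {x : FreeAbelianGroup D | ∃ T : Triangle D, T ∈ distTriang D ∧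
      x = FreeAbelianGroup.of T.obj₂ - FreeAbelianGroup.of T.obj₁ - FreeAbelianGroup.of T.obj₃}

/-- The class of an object in the Grothendieck group of a triangulated category. -/
def triCls {D : Type u} [Category.{v} D] [Preadditive D] [HasZeroObject D] [HasShift D ℤ]
    [∀ n : ℤ, (shiftFunctor D n).Additive] [Pretriangulated D] (X : D) : TriK₀ D :=
  QuotientAddGroup.mk (FreeAbelianGroup.of X)

/-- The Grothendieck group of an abelian category: generators are the objects, with a relation
`[Y] = [X] + [Z]` for every short exact sequence `0 ⟶ X ⟶ Y ⟶ Z ⟶ 0`. -/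
abbrev AbK₀ (A : Type u) [Category.{v} A] [Abelian A] : Type u :=
  FreeAbelianGroup A ⧸ AddSubgroup.closure
    {x : FreeAbelianGroup A | ∃ S : ShortComplex A, S.ShortExact ∧
      x = FreeAbelianGroup.of S.X₂ - FreeAbelianGroup.of S.X₁ - FreeAbelianGroup.of S.X₃}

/-- The class of an object in the Grothendieck group of an abelian category. -/
def abCls {A : Type u} [Category.{v} A] [Abelian A] (X : A) : AbK₀ A :=
  QuotientAddGroup.mk (FreeAbelianGroup.of X)

end Grothendieck

/-! ### Stability functions on abelian categories -/

section StabilityFunction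

variable {A : Type u} [Category.{v} A] [Abelian A]

/-- A homomorphism `Z : K(A) → ℂ` is a stability function if every nonzero object is sent to
a number `m exp(iπφ)` with `m > 0` and `0 < φ ≤ 1`. -/
def IsStabilityFunction (Z : AbK₀ A →+ ℂ) : Prop :=
  ∀ E : A, ¬ IsZero E → ∃ m φ : ℝ, 0 < m ∧ φ ∈ Set.Ioc (0 : ℝ) 1 ∧
    Z (abCls E) = (m : ℂ) * Complex.exp (Complex.I * Real.pi * φ)

/-- The phase of an object. If `Z` is a stability function and `E` is nonzero, this is the unique
`φ ∈ (0, 1]` such that `Z(E)` is a positive multiple of `exp(iπφ)`, since `Complex.arg` takes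
values in `(-π, π]`. -/
noncomputable def phase (Z : AbK₀ A →+ ℂ) (E : A) : ℝ :=
  Complex.arg (Z (abCls E)) / Real.pi

/-- A nonzero object is semistable if no nonzero subobject has larger phase. -/
def IsSemistable (Z : AbK₀ A →+ ℂ) (E : A) : Prop :=
  ¬ IsZero E ∧ ∀ F : Subobject E, ¬ IsZero (F : A) → phase Z (F : A) ≤ phase Z E

/-- The factor `E_{j+1}/E_j` of a filtration of `E` by subobjects. -/
noncomputable def factor {E : A} {n : ℕ} (F : Fin (n + 1) → Subobject E) (hF : Monotone F)
    (j : Fin n) : A :=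
  cokernel (Subobject.ofLE (F j.castSucc) (F j.succ) (hF (Fin.castSucc_lt_succ (i := j)).le))

/-- The Harder-Narasimhan property: every nonzero object has a finite filtration
`0 = E_0 ⊆ E_1 ⊆ ⋯ ⊆ E_n = E` with semistable factors of strictly decreasing phases. -/
def HasHNProperty (Z : AbK₀ A →+ ℂ) : Prop :=
  ∀ E : A, ¬ IsZero E → ∃ (n : ℕ) (F : Fin (n + 1) → Subobject E) (hF : Monotone F),
    F 0 = ⊥ ∧ F (Fin.last n) = ⊤ ∧ (∀ j : Fin n, IsSemistable Z (factor F hF j)) ∧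
    StrictAnti (fun j : Fin n => phase Z (factor F hF j))

end StabilityFunction

section Triangulated

variable {D : Type u} [Category.{v} D] [Preadditive D] [HasZeroObject D] [HasShift D ℤ]
  [∀ n : ℤ, (shiftFunctor D n).Additive] [Pretriangulated D]

/-! ### The heart of a t-structure is an abelian category -/

section Heart

variable (t : TStructure D)

instance heart_containsZero : t.heart.ContainsZero where
  exists_zero := by
    obtain ⟨Z, hZ⟩ := HasZeroObject.zero (C := D)
    exact ⟨Z, hZ, (t.mem_heart_iff _).2 ⟨t.isLE_of_isZero hZ 0, t.isGE_of_isZero hZ 0⟩⟩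

instance heart_isClosedUnderBinaryProducts : t.heart.IsClosedUnderBinaryProducts where
  limitsOfShape_le := by
    rintro X ⟨p⟩
    have h₁ := (t.mem_heart_iff _).1 (p.prop_diag_obj (.mk .left))
    have h₂ := (t.mem_heart_iff _).1 (p.prop_diag_obj (.mk .right))
    have hT := binaryProductTriangle_distinguished
      (p.diag.obj (.mk .left)) (p.diag.obj (.mk .right))
    refine t.heart.prop_of_iso ?_
      ((t.mem_heart_iff _).2 ⟨t.isLE₂ _ hT 0 h₁.1 h₂.1, t.isGE₂ _ hT 0 h₁.2 h₂.2⟩)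
    exact IsLimit.conePointUniqueUpToIso (prodIsProd _ _)
      ((IsLimit.postcomposeHomEquiv (diagramIsoPair p.diag) _).2 p.isLimit)

instance heart_isClosedUnderFiniteProducts : t.heart.IsClosedUnderFiniteProducts := .mk'

theorem heart_hom_shift_eq_zero ⦃X Y : t.heart.FullSubcategory⦄ ⦃n : ℤ⦄
    (f : t.heart.ι.obj X ⟶ (t.heart.ι.obj Y)⟦n⟧) (hn : n < 0) : f = 0 := by
  have hX := (t.mem_heart_iff _).1 X.property
  have hY := (t.mem_heart_iff _).1 Y.property
  have h₁ : t.IsLE (t.heart.ι.obj X) 0 := hX.1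
  have h₂ : t.IsGE (t.heart.ι.obj Y) 0 := hY.2
  have h₃ : t.IsGE ((t.heart.ι.obj Y)⟦n⟧) (-n) := t.isGE_shift _ 0 n (-n)
  exact t.zero f 0 (-n)

theorem heart_admissible :
    AbelianSubcategory.admissibleMorphism t.heart.ι = ⊤ := by
  refine top_unique ?_
  rintro X₁ X₂ f - X₃ g h hT
  have hX₁ := (t.mem_heart_iff _).1 X₁.property
  have hX₂ := (t.mem_heart_iff _).1 X₂.property
  have a₁ : t.IsLE (t.heart.ι.obj X₁) 0 := hX₁.1
  have b₁ : t.IsGE (t.heart.ι.obj X₁) 0 := hX₁.2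
  have a₂ : t.IsLE (t.heart.ι.obj X₂) 0 := hX₂.1
  have b₂ : t.IsGE (t.heart.ι.obj X₂) 0 := hX₂.2
  have c₁ : t.IsLE ((t.heart.ι.obj X₁)⟦(1 : ℤ)⟧) (-1) := t.isLE_shift _ 0 1 (-1)
  have c₂ : t.IsGE ((t.heart.ι.obj X₁)⟦(1 : ℤ)⟧) (-1) := t.isGE_shift _ 0 1 (-1)
  have hT' := rot_of_distTriang _ hT
  have d₁ : t.IsLE X₃ 0 := t.isLE₂ _ hT' 0 a₂ (t.isLE_of_le ((t.heart.ι.obj X₁)⟦(1 : ℤ)⟧) (-1) 0)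
  have d₂ : t.IsGE X₃ (-1) := t.isGE₂ _ hT' (-1) (t.isGE_of_ge (t.heart.ι.obj X₂) (-1) 0) c₂
  obtain ⟨U, V, hU, hV, α, β, γ, hS⟩ := t.exists_triangle X₃ (-1) 0 (by lia)
  have u₁ : t.IsLE U (-1) := ⟨hU⟩
  have v₁ : t.IsGE V 0 := ⟨hV⟩
  have v₂ : t.IsGE (V⟦(-1 : ℤ)⟧) (-1) :=
    have := t.isGE_shift V 0 (-1) 1
    t.isGE_of_ge _ (-1) 1
  have u₂ : t.IsGE U (-1) := t.isGE₂ _ (inv_rot_of_distTriang _ hS) (-1) v₂ d₂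
  have u₃ : t.IsLE (U⟦(1 : ℤ)⟧) 0 :=
    have := t.isLE_shift U (-1) 1 (-2)
    t.isLE_of_le _ (-2) 0
  have v₃ : t.IsLE V 0 := t.isLE₂ _ (rot_of_distTriang _ hS) 0 d₁ u₃
  have k₁ : t.IsLE (U⟦(-1 : ℤ)⟧) 0 := t.isLE_shift U (-1) (-1) 0
  have k₂ : t.IsGE (U⟦(-1 : ℤ)⟧) 0 := t.isGE_shift U (-1) (-1) 0
  let e : (U⟦(-1 : ℤ)⟧)⟦(1 : ℤ)⟧ ≅ U := (shiftEquiv D (1 : ℤ)).counitIso.app U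
  refine ⟨⟨_, (t.mem_heart_iff _).2 ⟨k₁, k₂⟩⟩, ⟨V, (t.mem_heart_iff _).2 ⟨v₃, v₁⟩⟩,
    e.hom ≫ α, β, γ ≫ e.inv⟦(1 : ℤ)⟧', ?_⟩
  refine isomorphic_distinguished _ hS _ ?_
  have hγ : (γ ≫ e.inv⟦(1 : ℤ)⟧') ≫ e.hom⟦(1 : ℤ)⟧' = 𝟙 V ≫ γ := by
    rw [Category.assoc, ← Functor.map_comp, e.inv_hom_id, CategoryTheory.Functor.map_id, Category.comp_id,
      Category.id_comp]
  exact Triangle.isoMk _ _ e (Iso.refl _) (Iso.refl _) (Category.comp_id (e.hom ≫ α))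
    ((Category.comp_id β).trans (Category.id_comp β).symm) hγ

noncomputable instance heartAbelian [IsTriangulated D] : Abelian t.heart.FullSubcategory :=
  AbelianSubcategory.abelian t.heart.ι (heart_hom_shift_eq_zero t) (heart_admissible t)

end Heart

/-! ### Stability conditions -/

/-- The extension-closed full subcategory generated by a class of objects. It is closed under
isomorphisms, since `X ≅ Y` gives a distinguished triangle `X ⟶ Y ⟶ 0 ⟶ X⟦1⟧`. -/
inductive ExtClosure (Q : ObjectProperty D) : ObjectProperty D
  | of (X : D) (hX : Q X) : ExtClosure Q X
  | zero (X : D) (hX : IsZero X) : ExtClosure Q X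
  | ext (X Y Z : D) (f : X ⟶ Y) (g : Y ⟶ Z) (h : Z ⟶ X⟦(1 : ℤ)⟧)
      (hT : Triangle.mk f g h ∈ distTriang D) (hX : ExtClosure Q X) (hZ : ExtClosure Q Z) :
      ExtClosure Q Y

/-- Distinguished triangles `E_j ⟶ E_{j+1} ⟶ A_{j+1} ⟶ E_j⟦1⟧` with `E_0 = 0` and `E_n ≅ E`,
whose factors lie in `P(φ_1), …, P(φ_n)` for a sequence `φ_1 > ⋯ > φ_n`. -/
structure HNTower (P : ℝ → ObjectProperty D) (E : D) where
  n : ℕ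
  φ : Fin n → ℝ
  strictAnti : StrictAnti φ
  obj : Fin (n + 1) → D
  fac : Fin n → D
  f : ∀ j : Fin n, obj j.castSucc ⟶ obj j.succ
  g : ∀ j : Fin n, obj j.succ ⟶ fac j
  h : ∀ j : Fin n, fac j ⟶ (obj j.castSucc)⟦(1 : ℤ)⟧
  distinguished : ∀ j : Fin n, Triangle.mk (f j) (g j) (h j) ∈ distTriang D
  isZero_obj_zero : IsZero (obj 0)
  isoLast : obj (Fin.last n) ≅ E
  mem : ∀ j : Fin n, P (φ j) (fac j)

variable (D) in
/-- A stability condition on `D`: a central charge `Z` and strictly full additive subcategories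
`P φ` for `φ : ℝ`. -/
@[ext]
structure StabilityCondition where
  Z : TriK₀ D →+ ℂ
  P : ℝ → ObjectProperty D
  of_iso : ∀ (φ : ℝ) (X Y : D), Nonempty (X ≅ Y) → P φ X → P φ Y
  of_isZero : ∀ (φ : ℝ) (X : D), IsZero X → P φ X
  biprod : ∀ (φ : ℝ) (X Y : D), P φ X → P φ Y → P φ (X ⊞ Y)
  charge : ∀ (φ : ℝ) (E : D), P φ E → ¬ IsZero E →
    ∃ m : ℝ, 0 < m ∧ Z (triCls E) = (m : ℂ) * Complex.exp (Complex.I * Real.pi * φ)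
  shift : ∀ φ : ℝ, P (φ + 1) = (P φ).map (shiftFunctor D (1 : ℤ))
  hom_eq_zero : ∀ (φ₁ φ₂ : ℝ), φ₂ < φ₁ → ∀ (A₁ A₂ : D), P φ₁ A₁ → P φ₂ A₂ →
    ∀ f : A₁ ⟶ A₂, f = 0
  exists_tower : ∀ E : D, ¬ IsZero E → Nonempty (HNTower P E)

/-- `P(I)`, the extension-closed subcategory generated by the `P φ` with `φ ∈ I`. -/
def StabilityCondition.interval (σ : StabilityCondition D) (I : Set ℝ) : ObjectProperty D :=
  ExtClosure (fun X => ∃ φ ∈ I, σ.P φ X)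

/-- A t-structure is bounded if every object lies between two degrees. -/
def IsBoundedTStructure (t : TStructure D) : Prop :=
  ∀ X : D, ∃ a b : ℤ, t.ge a X ∧ t.le b X

variable (D) in
/-- A bounded t-structure on `D` together with a stability function on its heart that has the
Harder-Narasimhan property. -/
@[ext]
structure HeartStability [IsTriangulated D] where
  t : TStructure D
  bounded : IsBoundedTStructure t
  Z : AbK₀ t.heart.FullSubcategory →+ ℂ
  isStabilityFunction : IsStabilityFunction Z
  hasHN : HasHNProperty Z

/-- For `φ ∈ (0, 1]`, the full subcategory of `D` of the semistable objects of phase `φ` of the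
heart, together with the zero objects. -/
def HeartStability.semistable [IsTriangulated D] (h : HeartStability D) (φ : ℝ) :
    ObjectProperty D :=
  fun X => IsZero X ∨ ∃ hX : h.t.heart X,
    IsSemistable h.Z (⟨X, hX⟩ : h.t.heart.FullSubcategory) ∧
      phase h.Z (⟨X, hX⟩ : h.t.heart.FullSubcategory) = φ

end Triangulated

end BridgelandStability

open BridgelandStability

namespace BridgelandStability

/-! For a bounded heart the map of Grothendieck groups is onto because truncation builds every
object from shifts of heart objects. It is injective because the Euler class, the alternating sum of
the classes of the cohomology objects, is a left inverse (`heartK₀Equiv`). The point is additivity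
of this class on distinguished triangles (`DistTri.eulerClass`). In place of the long exact
cohomology sequence, `EulerAdditive.of_rotate` splits the top cohomology off the third vertex by the
octahedral axiom and rotates; three such moves raise all lower bounds by one, until the objects
vanish.

From a stability condition to a heart: cutting a Harder–Narasimhan tower at a phase gives truncation
triangles, and the vanishing of `Hom` gives orthogonality, so a t-structure with heart `P((0, 1])`
arises. If `E` lies in `P φ`, the part of phase `> φ` of a subobject of `E` maps to zero in `E`,
hence vanishes, so `E` is semistable (`isSemistable_of_P`). Conversely, a semistable object with two
or more factors would be destabilised by the preceding stage of its tower (`P_of_isSemistable`).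

From a heart to a stability condition: the charge is transported along the isomorphism of
Grothendieck groups, and the slices are shifts of the semistable objects. Morphisms to lower phases
vanish by the t-structure for different shifts, and by comparing the image with source and target
for equal shifts. Towers come from concatenating the filtrations of the cohomology objects. The two
constructions are mutually inverse because the two halves of a t-structure determine each other by
orthogonality, and a charge is determined by its values on the heart. -/

theorem isZero_of_shift {D : Type u} [Category.{v} D] [Preadditive D] [HasShift D ℤ]
    [∀ n : ℤ, (shiftFunctor D n).Additive] {X : D} (n : ℤ) (h : IsZero (X⟦n⟧)) : IsZero X := by
  rw [IsZero.iff_id_eq_zero] at h ⊢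
  apply (shiftFunctor D n).map_injective
  rw [CategoryTheory.Functor.map_id, Functor.map_zero, h]

/-! ### Distinguished triangles up to the choice of morphisms -/

section DistTri

variable {D : Type u} [Category.{v} D] [Preadditive D] [HasZeroObject D] [HasShift D ℤ]
  [∀ n : ℤ, (shiftFunctor D n).Additive] [Pretriangulated D]

/-- There is a distinguished triangle with the given objects. -/
def DistTri (X Y Z : D) : Prop :=
  ∃ (f : X ⟶ Y) (g : Y ⟶ Z) (h : Z ⟶ X⟦(1 : ℤ)⟧), Triangle.mk f g h ∈ distTriang D

theorem DistTri.of_mem {T : Triangle D} (hT : T ∈ distTriang D) : DistTri T.obj₁ T.obj₂ T.obj₃ :=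
  ⟨T.mor₁, T.mor₂, T.mor₃, hT⟩

theorem DistTri.rotate {X Y Z : D} (h : DistTri X Y Z) : DistTri Y Z (X⟦(1 : ℤ)⟧) := by
  obtain ⟨f, g, h, hT⟩ := h
  exact .of_mem (rot_of_distTriang _ hT)

theorem DistTri.invRotate {X Y Z : D} (h : DistTri X Y Z) : DistTri (Z⟦(-1 : ℤ)⟧) X Y := by
  obtain ⟨f, g, h, hT⟩ := h
  exact .of_mem (inv_rot_of_distTriang _ hT)

theorem DistTri.shift {X Y Z : D} (h : DistTri X Y Z) (n : ℤ) :
    DistTri (X⟦n⟧) (Y⟦n⟧) (Z⟦n⟧) := by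
  obtain ⟨f, g, h, hT⟩ := h
  exact .of_mem (Triangle.shift_distinguished _ hT n)

theorem DistTri.of_iso {X Y Z X' Y' Z' : D} (h : DistTri X Y Z) (e₁ : X ≅ X') (e₂ : Y ≅ Y')
    (e₃ : Z ≅ Z') : DistTri X' Y' Z' := by
  obtain ⟨f, g, h, hT⟩ := h
  refine ⟨e₁.inv ≫ f ≫ e₂.hom, e₂.inv ≫ g ≫ e₃.hom, e₃.inv ≫ h ≫ e₁.hom⟦(1 : ℤ)⟧',
    isomorphic_distinguished _ hT _ (Triangle.isoMk _ _ e₁.symm e₂.symm e₃.symm ?_ ?_ ?_)⟩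
  · change (e₁.inv ≫ f ≫ e₂.hom) ≫ e₂.inv = e₁.inv ≫ f
    simp
  · change (e₂.inv ≫ g ≫ e₃.hom) ≫ e₃.inv = e₂.inv ≫ g
    simp
  · change (e₃.inv ≫ h ≫ e₁.hom⟦(1 : ℤ)⟧') ≫ e₁.inv⟦(1 : ℤ)⟧' = e₃.inv ≫ h
    simp [← Functor.map_comp]

theorem DistTri.of_isZero₁ {X Y Z : D} (h : IsZero X) (e : Y ≅ Z) : DistTri X Y Z :=
  ⟨0, e.hom, 0, (Triangle.distinguished_iff_of_isZero₁ _ h).2 (inferInstanceAs (IsIso e.hom))⟩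

theorem DistTri.of_isZero₃ {X Y Z : D} (h : IsZero Z) (e : X ≅ Y) : DistTri X Y Z :=
  ⟨e.hom, 0, 0, (Triangle.distinguished_iff_of_isZero₃ _ h).2 (inferInstanceAs (IsIso e.hom))⟩

theorem DistTri.iso_of_isZero₁ {X Y Z : D} (h : DistTri X Y Z) (hX : IsZero X) :
    Nonempty (Y ≅ Z) := by
  obtain ⟨f, g, h, hT⟩ := h
  have : IsIso g := (Triangle.isZero₁_iff_isIso₂ _ hT).1 hX
  exact ⟨asIso g⟩

theorem DistTri.iso_of_isZero₃ {X Y Z : D} (h : DistTri X Y Z) (hZ : IsZero Z) :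
    Nonempty (X ≅ Y) := by
  obtain ⟨f, g, h, hT⟩ := h
  have : IsIso f := (Triangle.isZero₃_iff_isIso₁ _ hT).1 hZ
  exact ⟨asIso f⟩

theorem DistTri.biprod (X Y : D) : DistTri X (X ⊞ Y) Y :=
  .of_mem (binaryBiproductTriangle_distinguished X Y)

/-- Octahedral axiom for a composition of two first maps. -/
theorem DistTri.comp_left [IsTriangulated D] {U E V X A : D} (h₁ : DistTri U E V)
    (h₂ : DistTri E X A) : ∃ W, DistTri U X W ∧ DistTri V W A := by
  obtain ⟨f, g, h, hT⟩ := h₁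
  obtain ⟨f', g', h', hT'⟩ := h₂
  obtain ⟨W, a, b, hW⟩ := distinguished_cocone_triangle (f ≫ f')
  exact ⟨W, ⟨_, _, _, hW⟩, .of_mem (someOctahedron rfl hT hT' hW).mem⟩

/-- Octahedral axiom for a composition of two second maps. -/
theorem DistTri.comp_right [IsTriangulated D] {E X A A' S : D} (h₁ : DistTri E X A)
    (h₂ : DistTri A' A S) : ∃ W, DistTri W X S ∧ DistTri E W A' := by
  obtain ⟨W', hW, hW'⟩ := h₁.rotate.comp_left h₂.rotate
  exact ⟨W'⟦(-1 : ℤ)⟧, hW.invRotate, (hW'.shift (-1)).of_iso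
    ((shiftEquiv D (1 : ℤ)).unitIso.symm.app _) (Iso.refl _)
    ((shiftEquiv D (1 : ℤ)).unitIso.symm.app _)⟩

theorem DistTri.zero_hom_of {X Y Z W : D} (h : DistTri X Y Z) (h₁ : ∀ f : X ⟶ W, f = 0)
    (h₃ : ∀ f : Z ⟶ W, f = 0) (f : Y ⟶ W) : f = 0 := by
  obtain ⟨a, b, c, hT⟩ := h
  obtain ⟨g, hg⟩ : ∃ g : Z ⟶ W, f = b ≫ g := Triangle.yoneda_exact₂ _ hT f (h₁ _)
  rw [hg, h₃ g, Limits.comp_zero]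

theorem DistTri.hom_zero_of {X Y Z W : D} (h : DistTri X Y Z) (h₁ : ∀ f : W ⟶ X, f = 0)
    (h₃ : ∀ f : W ⟶ Z, f = 0) (f : W ⟶ Y) : f = 0 := by
  obtain ⟨a, b, c, hT⟩ := h
  obtain ⟨g, hg⟩ : ∃ g : W ⟶ X, f = g ≫ a := Triangle.coyoneda_exact₂ _ hT f (h₃ _)
  rw [hg, h₁ g, zero_comp]

/-- The identity of `Z` is killed by `Y ⟶ Z`, so it factors through `X⟦1⟧`. -/
theorem DistTri.isZero₃_of_hom_zero {X Y Z : D} (h : DistTri X Y Z) (h₁ : ∀ f : Y ⟶ Z, f = 0)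
    (h₂ : ∀ f : X⟦(1 : ℤ)⟧ ⟶ Z, f = 0) : IsZero Z := by
  obtain ⟨a, b, c, hT⟩ := h
  rw [IsZero.iff_id_eq_zero]
  obtain ⟨g, hg⟩ : ∃ g : X⟦(1 : ℤ)⟧ ⟶ Z, 𝟙 Z = c ≫ g := Triangle.yoneda_exact₃ _ hT (𝟙 Z)
    (by change b ≫ 𝟙 _ = 0; rw [Category.comp_id]; exact h₁ b)
  rw [hg, h₂ g, comp_zero]

end DistTri

/-! ### Short exact sequences in the heart -/

section Heart

variable {D : Type u} [Category.{v} D] [Preadditive D] [HasZeroObject D] [HasShift D ℤ]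
  [∀ n : ℤ, (shiftFunctor D n).Additive] [Pretriangulated D]
  (t : TStructure D)

theorem heart_isZero_iff {X : t.heart.FullSubcategory} : IsZero X ↔ IsZero X.obj := by
  rw [IsZero.iff_id_eq_zero, IsZero.iff_id_eq_zero]
  exact ⟨fun h => congrArg (fun f : X ⟶ X => f.hom) h, fun h => ObjectProperty.hom_ext _ h⟩

variable [IsTriangulated D]

/-- A distinguished triangle of objects of the heart is a short exact sequence. -/
theorem heart_shortExact {X Y Z : t.heart.FullSubcategory} (h : DistTri X.obj Y.obj Z.obj) :
    ∃ (f : X ⟶ Y) (g : Y ⟶ Z) (w : f ≫ g = 0), (ShortComplex.mk f g w).ShortExact := by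
  obtain ⟨f, g, h, hT⟩ := h
  let f' : X ⟶ Y := ObjectProperty.homMk f
  let g' : Y ⟶ Z := ObjectProperty.homMk g
  have hT' : Triangle.mk (t.heart.ι.map f') (t.heart.ι.map g') h ∈ distTriang D := hT
  have w : f' ≫ g' = 0 := ObjectProperty.hom_ext _ (comp_distTriang_mor_zero₁₂ _ hT)
  let S := ShortComplex.mk f' g' w
  have hk : IsLimit (KernelFork.ofι S.f S.zero) := AbelianSubcategory.isLimitKernelForkOfDistTriang
    (heart_hom_shift_eq_zero t) f' g' h hT'
  have hc : IsColimit (CokernelCofork.ofπ S.g S.zero) := AbelianSubcategory.isColimitCokernelCoforkOfDistTriang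
    (heart_hom_shift_eq_zero t) f' g' h hT'
  have : Mono S.f := mono_of_isLimit_fork hk
  have : Epi S.g := epi_of_isColimit_cofork hc
  exact ⟨f', g', w, ⟨S.exact_of_f_is_kernel hk⟩⟩

/-- An epimorphism of the heart completes to a triangle whose first vertex lies in the heart and is
its kernel; uniqueness of kernels identifies that vertex with `S.X₁`. -/
theorem heart_distTri {S : ShortComplex t.heart.FullSubcategory} (hS : S.ShortExact) :
    DistTri S.X₁.obj S.X₂.obj S.X₃.obj := by
  have := hS.epi_g
  obtain ⟨X, i, δ, hT⟩ := AbelianSubcategory.exists_distinguished_triangle_of_epi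
    (heart_hom_shift_eq_zero t) (heart_admissible t) S.g
  have hk := AbelianSubcategory.isLimitKernelForkOfDistTriang
    (heart_hom_shift_eq_zero t) i S.g δ hT
  let e : X ≅ S.X₁ := IsLimit.conePointUniqueUpToIso hk hS.fIsKernel
  exact (DistTri.of_mem hT).of_iso (t.heart.ι.mapIso e) (Iso.refl _) (Iso.refl _)

end Heart

/-! ### The Grothendieck group of an abelian category -/

section AbelianK₀

variable {A : Type u} [Category.{v} A] [Abelian A]

theorem abCls_shortExact {S : ShortComplex A} (hS : S.ShortExact) :
    abCls S.X₂ = abCls S.X₁ + abCls S.X₃ := by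
  have : (QuotientAddGroup.mk (FreeAbelianGroup.of S.X₂ - FreeAbelianGroup.of S.X₁ -
      FreeAbelianGroup.of S.X₃) : AbK₀ A) = 0 :=
    (QuotientAddGroup.eq_zero_iff _).2 (AddSubgroup.subset_closure ⟨S, hS, rfl⟩)
  have h2 : abCls S.X₂ - abCls S.X₁ - abCls S.X₃ = 0 := this
  rw [← sub_eq_zero, ← h2]; abel

/-- The universal property of the Grothendieck group of an abelian category. -/
def abLift {G : Type*} [AddCommGroup G] (φ : A → G)
    (h : ∀ S : ShortComplex A, S.ShortExact → φ S.X₂ = φ S.X₁ + φ S.X₃) : AbK₀ A →+ G :=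
  QuotientAddGroup.lift _ (FreeAbelianGroup.lift φ) (by
    rw [AddSubgroup.closure_le]
    rintro _ ⟨S, hS, rfl⟩
    simp [h S hS])

theorem abLift_abCls {G : Type*} [AddCommGroup G] (φ : A → G)
    (h : ∀ S : ShortComplex A, S.ShortExact → φ S.X₂ = φ S.X₁ + φ S.X₃) (X : A) :
    abLift φ h (abCls X) = φ X := by
  change FreeAbelianGroup.lift φ (FreeAbelianGroup.of X) = _
  simp

theorem abK₀_hom_ext {G : Type*} [AddCommGroup G] {f g : AbK₀ A →+ G}
    (h : ∀ X, f (abCls X) = g (abCls X)) : f = g :=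
  QuotientAddGroup.addMonoidHom_ext _ (FreeAbelianGroup.lift_ext _ _ h)

theorem abCls_of_isZero {X : A} (hX : IsZero X) : abCls X = 0 := by
  have := abCls_shortExact (S := ShortComplex.mk (0 : X ⟶ X) (0 : X ⟶ X) comp_zero)
    { exact := ShortComplex.exact_of_isZero_X₂ _ hX
      mono_f := ⟨fun _ _ _ => hX.eq_of_tgt _ _⟩
      epi_g := ⟨fun _ _ _ => hX.eq_of_src _ _⟩ }
  simpa using this

theorem abCls_iso {X Y : A} (e : X ≅ Y) : abCls X = abCls Y := by
  obtain ⟨Z, hZ⟩ := HasZeroObject.zero (C := A)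
  have := abCls_shortExact (S := ShortComplex.mk e.hom (0 : Y ⟶ Z) Limits.comp_zero)
    { exact := (ShortComplex.exact_iff_epi _ rfl).2 inferInstance
      mono_f := inferInstance
      epi_g := ⟨fun _ _ _ => hZ.eq_of_src _ _⟩ }
  rw [abCls_of_isZero hZ, add_zero] at this
  exact this.symm

end AbelianK₀

/-! ### The Grothendieck group of a triangulated category -/

section TriangulatedK₀

variable {D : Type u} [Category.{v} D] [Preadditive D] [HasZeroObject D] [HasShift D ℤ]
  [∀ n : ℤ, (shiftFunctor D n).Additive] [Pretriangulated D]

theorem DistTri.triCls {X Y Z : D} (h : DistTri X Y Z) :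
    triCls Y = triCls X + triCls Z := by
  obtain ⟨f, g, h, hT⟩ := h
  have : (QuotientAddGroup.mk (FreeAbelianGroup.of Y - FreeAbelianGroup.of X -
      FreeAbelianGroup.of Z) : TriK₀ D) = 0 :=
    (QuotientAddGroup.eq_zero_iff _).2 (AddSubgroup.subset_closure ⟨_, hT, rfl⟩)
  have h2 : BridgelandStability.triCls Y - BridgelandStability.triCls X -
    BridgelandStability.triCls Z = 0 := this
  rw [← sub_eq_zero, ← h2]; abel

/-- The universal property of the Grothendieck group of a triangulated category. -/
def triLift {G : Type*} [AddCommGroup G] (φ : D → G)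
    (h : ∀ X Y Z : D, DistTri X Y Z → φ Y = φ X + φ Z) : TriK₀ D →+ G :=
  QuotientAddGroup.lift _ (FreeAbelianGroup.lift φ) (by
    rw [AddSubgroup.closure_le]
    rintro _ ⟨T, hT, rfl⟩
    simp [h _ _ _ (.of_mem hT)])

theorem triLift_triCls {G : Type*} [AddCommGroup G] (φ : D → G)
    (h : ∀ X Y Z : D, DistTri X Y Z → φ Y = φ X + φ Z) (X : D) :
    triLift φ h (triCls X) = φ X := by
  change FreeAbelianGroup.lift φ (FreeAbelianGroup.of X) = _
  simp

theorem triCls_of_isZero {X : D} (hX : IsZero X) : triCls X = 0 := by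
  have := (DistTri.of_isZero₁ hX (Iso.refl X)).triCls
  simpa using this

theorem triCls_iso {X Y : D} (e : X ≅ Y) : triCls X = triCls Y := by
  have := (DistTri.of_isZero₃ (isZero_zero D) e).triCls
  rw [triCls_of_isZero (isZero_zero D), add_zero] at this
  exact this.symm

theorem triCls_shift_one (X : D) : triCls (X⟦(1 : ℤ)⟧) = - triCls X := by
  have := (DistTri.of_isZero₁ (isZero_zero D) (Iso.refl X)).rotate.rotate.triCls
  have h2 := (DistTri.of_isZero₃ (isZero_zero D) (Iso.refl X)).rotate.triCls
  rw [triCls_of_isZero (isZero_zero D)] at h2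
  rw [eq_neg_iff_add_eq_zero, add_comm, ← h2]

theorem triCls_shift (X : D) (n : ℤ) : triCls (X⟦n⟧) = n.negOnePow • triCls X := by
  induction n using Int.induction_on with
  | zero => simpa using triCls_iso ((shiftFunctorZero D ℤ).app X)
  | succ n ih =>
    rw [triCls_iso ((shiftFunctorAdd D (n : ℤ) 1).app X)]
    change triCls ((X⟦(n : ℤ)⟧)⟦(1 : ℤ)⟧) = _
    rw [triCls_shift_one, ih, Int.negOnePow_succ, Units.neg_smul]
  | pred n ih =>
    have h := triCls_iso ((shiftFunctorAdd' D (-(n : ℤ) - 1) 1 (-n) (by lia)).app X)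
    change _ = triCls ((X⟦(-(n : ℤ) - 1)⟧)⟦(1 : ℤ)⟧) at h
    rw [triCls_shift_one, ih] at h
    rw [← neg_neg (triCls _), ← h, Int.negOnePow_sub, Int.negOnePow_one]
    simp

end TriangulatedK₀

/-! ### The Euler class and the isomorphism of Grothendieck groups -/

section EulerClass

variable {D : Type u} [Category.{v} D] [Preadditive D] [HasZeroObject D] [HasShift D ℤ]
  [∀ n : ℤ, (shiftFunctor D n).Additive] [Pretriangulated D]
  (t : TStructure D)

theorem DistTri.isLE₂ {X Y Z : D} (h : DistTri X Y Z) (n : ℤ) (h₁ : t.IsLE X n) (h₃ : t.IsLE Z n) :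
    t.IsLE Y n := by
  obtain ⟨f, g, h, hT⟩ := h
  exact TStructure.isLE₂ t _ hT n h₁ h₃

theorem DistTri.isGE₂ {X Y Z : D} (h : DistTri X Y Z) (n : ℤ) (h₁ : t.IsGE X n) (h₃ : t.IsGE Z n) :
    t.IsGE Y n := by
  obtain ⟨f, g, h, hT⟩ := h
  exact TStructure.isGE₂ t _ hT n h₁ h₃

theorem DistTri.isLE₃ {X Y Z : D} (h : DistTri X Y Z) (n : ℤ) (h₁ : t.IsLE X (n + 1))
    (h₂ : t.IsLE Y n) : t.IsLE Z n :=
  h.rotate.isLE₂ t n h₂ (t.isLE_shift X (n + 1) 1 n)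

theorem DistTri.isGE₁ {X Y Z : D} (h : DistTri X Y Z) (n : ℤ) (h₂ : t.IsGE Y n)
    (h₃ : t.IsGE Z (n - 1)) : t.IsGE X n :=
  h.invRotate.isGE₂ t n (t.isGE_shift Z (n - 1) (-1) n) h₂

theorem exists_distTri_heart (X : D) (hX : t.IsLE X 0) :
    ∃ U H : D, t.IsLE U (-1) ∧ t.heart H ∧ DistTri U X H := by
  obtain ⟨U, H, hU, hH, f, g, h, hT⟩ := t.exists_triangle X (-1) 0 rfl
  have hUX : DistTri U X H := ⟨f, g, h, hT⟩
  have : t.IsLE U (-1) := ⟨hU⟩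
  exact ⟨U, H, ⟨hU⟩, (t.mem_heart_iff _).2
    ⟨hUX.isLE₃ t 0 (t.isLE_of_le U (-1) _) hX, ⟨hH⟩⟩, hUX⟩

variable [IsTriangulated D]

/-- The zeroth cohomology object of `X` with respect to a t-structure. -/
noncomputable def cohomology₀ (X : D) : t.heart.FullSubcategory :=
  ⟨(t.truncGE 0).obj ((t.truncLE 0).obj X),
    (t.mem_heart_iff _).2 ⟨inferInstance, inferInstance⟩⟩

theorem cohomology₀_isZero_of_isLE (X : D) (h : t.IsLE X (-1)) : IsZero (cohomology₀ t X) := by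
  rw [heart_isZero_iff]
  have : t.IsLE ((t.truncLE 0).obj X) (-1) := by dsimp [TStructure.truncLE]; infer_instance
  exact t.isZero_truncGE_obj_of_isLE (-1) 0 rfl _

theorem cohomology₀_isZero_of_isGE (X : D) (h : t.IsGE X 1) : IsZero (cohomology₀ t X) := by
  rw [heart_isZero_iff]
  exact Functor.map_isZero (t.truncGE 0) (t.isZero_truncLE_obj_of_isGE 0 1 rfl X)

theorem nonempty_cohomology₀_iso_of_iso {X Y : D} (e : X ≅ Y) :
    Nonempty (cohomology₀ t X ≅ cohomology₀ t Y) :=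
  ⟨ObjectProperty.isoMk _ ((t.truncLE 0 ⋙ t.truncGE 0).mapIso e)⟩

theorem DistTri.nonempty_cohomology₀_iso {X Y Z : D} (h : DistTri X Y Z) (hZ : t.IsGE Z 1) :
    Nonempty (cohomology₀ t X ≅ cohomology₀ t Y) := by
  obtain ⟨f, g, h, hT⟩ := h
  have : IsIso ((t.truncLE 0).map f) := t.isIso₁_truncLE_map_of_isGE _ hT 0 1 rfl hZ
  exact ⟨ObjectProperty.isoMk _ ((t.truncGE 0).mapIso (asIso ((t.truncLE 0).map f)))⟩

theorem DistTri.nonempty_cohomology₀_iso_heart {U X H : D} (h : DistTri U X H) (hU : t.IsLE U (-1))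
    (hX : t.IsLE X 0) (hH : t.heart H) : Nonempty (cohomology₀ t X ≅ ⟨H, hH⟩) := by
  obtain ⟨f, g, h, hT⟩ := h
  have : IsIso ((t.truncGE 0).map g) := t.isIso₂_truncGE_map_of_isLE _ hT (-1) 0 rfl hU
  have h₁ : IsIso ((t.truncLEι 0).app X) := (t.isLE_iff_isIso_truncLEι_app 0 X).1 hX
  have h₂ : t.IsGE H 0 := ((t.mem_heart_iff _).1 hH).2
  exact ⟨ObjectProperty.isoMk _ ((t.truncGE 0).mapIso (asIso ((t.truncLEι 0).app X)) ≪≫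
    asIso ((t.truncGE 0).map g) ≪≫ (asIso ((t.truncGEπ 0).app H)).symm)⟩

/-- The signed class of the `i`-th cohomology object. -/
noncomputable def eulerTerm (X : D) (i : ℤ) : AbK₀ t.heart.FullSubcategory :=
  i.negOnePow • abCls (cohomology₀ t (X⟦i⟧))

theorem eulerTerm_of_isLE (X : D) (b i : ℤ) (hX : t.IsLE X b) (hi : b < i) :
    eulerTerm t X i = 0 := by
  have h₁ := t.isLE_shift X b i (b - i)
  have h₂ := t.isLE_of_le (X⟦i⟧) (b - i) (-1)
  rw [eulerTerm, abCls_of_isZero (cohomology₀_isZero_of_isLE t _ h₂), smul_zero]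

theorem eulerTerm_of_isGE (X : D) (a i : ℤ) (hX : t.IsGE X a) (hi : i < a) :
    eulerTerm t X i = 0 := by
  have h₁ := t.isGE_shift X a i (a - i)
  have h₂ := t.isGE_of_ge (X⟦i⟧) 1 (a - i)
  rw [eulerTerm, abCls_of_isZero (cohomology₀_isZero_of_isGE t _ h₂), smul_zero]

theorem eulerTerm_shift (X : D) (n i : ℤ) :
    eulerTerm t (X⟦n⟧) i = n.negOnePow • eulerTerm t X (n + i) := by
  obtain ⟨e⟩ := nonempty_cohomology₀_iso_of_iso t ((shiftFunctorAdd D n i).app X)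
  rw [eulerTerm, eulerTerm, abCls_iso e, smul_smul, Int.negOnePow_add, ← mul_assoc,
    Int.units_mul_self, one_mul]
  rfl

/-- The alternating sum of the classes of the cohomology objects. -/
noncomputable def eulerClass (X : D) : AbK₀ t.heart.FullSubcategory := ∑ᶠ i, eulerTerm t X i

theorem eulerClass_shift (X : D) (n : ℤ) :
    eulerClass t (X⟦n⟧) = n.negOnePow • eulerClass t X := by
  rw [eulerClass, finsum_congr (eulerTerm_shift t X n), eulerClass,
    ← finsum_comp_equiv (f := eulerTerm t X) (Equiv.addLeft n)]
  obtain h | h := Int.units_eq_one_or n.negOnePow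
  · simp [h]
  · simp [h, Units.neg_smul, finsum_neg_distrib]

theorem eulerClass_of_isZero {X : D} (hX : IsZero X) : eulerClass t X = 0 := by
  have : ∀ i, eulerTerm t X i = 0 := fun i =>
    eulerTerm_of_isLE t X (i - 1) i (t.isLE_of_isZero hX _) (by lia)
  rw [eulerClass, finsum_congr this, finsum_zero]

variable {t}

theorem eulerTerm_support_finite (ht : IsBoundedTStructure t) (X : D) :
    (Function.support (eulerTerm t X)).Finite := by
  obtain ⟨a, b, ha, hb⟩ := ht X
  refine (Set.finite_Icc a b).subset fun i hi => ?_
  by_contra h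
  rw [Set.mem_Icc, not_and_or, not_le, not_le] at h
  obtain h | h := h
  · exact hi (eulerTerm_of_isGE t X a i ⟨ha⟩ h)
  · exact hi (eulerTerm_of_isLE t X b i ⟨hb⟩ h)

/-- The comparison is degree by degree: `H` does not affect negative degrees, degree `0` of `X` is
`H` while that of `U` vanishes, and nothing lives in positive degrees. -/
theorem eulerClass_eq_add_heart (ht : IsBoundedTStructure t) {U X H : D} (h : DistTri U X H)
    (hU : t.IsLE U (-1)) (hH : t.heart H) :
    eulerClass t X = eulerClass t U + abCls (⟨H, hH⟩ : t.heart.FullSubcategory) := by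
  have hH' := (t.mem_heart_iff _).1 hH
  have hH₁ := hH'.2
  have hX : t.IsLE X 0 := h.isLE₂ t 0 (t.isLE_of_le U (-1) 0) hH'.1
  have key : ∀ i, eulerTerm t X i = eulerTerm t U i +
      (Pi.single 0 (abCls (⟨H, hH⟩ : t.heart.FullSubcategory)) :
        ℤ → AbK₀ t.heart.FullSubcategory) i := by
    intro i
    obtain hi | rfl | hi := lt_trichotomy i 0
    · rw [Pi.single_eq_of_ne hi.ne, add_zero]
      have h₁ := t.isGE_shift H 0 i (-i)
      obtain ⟨e⟩ := (h.shift i).nonempty_cohomology₀_iso t (t.isGE_of_ge _ 1 (-i))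
      rw [eulerTerm, eulerTerm, abCls_iso e]
    · rw [Pi.single_eq_same, eulerTerm_of_isLE t U (-1) 0 hU (by lia), zero_add]
      obtain ⟨e⟩ := nonempty_cohomology₀_iso_of_iso t ((shiftFunctorZero D ℤ).app X)
      obtain ⟨e'⟩ := h.nonempty_cohomology₀_iso_heart t hU hX hH
      rw [eulerTerm, abCls_iso (e ≪≫ e'), Int.negOnePow_zero, one_smul]
    · rw [Pi.single_eq_of_ne hi.ne', add_zero, eulerTerm_of_isLE t X 0 i hX hi,
        eulerTerm_of_isLE t U (-1) i hU (by lia)]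
  rw [eulerClass, finsum_congr key, finsum_add_distrib (eulerTerm_support_finite ht U)
    ((Set.finite_singleton 0).subset (by
      intro i hi
      by_contra h
      exact hi (Pi.single_eq_of_ne h _))), eulerClass]
  congr 1
  rw [finsum_eq_single _ 0 (fun i hi => Pi.single_eq_of_ne hi _), Pi.single_eq_same]

theorem eulerClass_heart (ht : IsBoundedTStructure t) (E : t.heart.FullSubcategory) :
    eulerClass t E.obj = abCls E := by
  rw [eulerClass_eq_add_heart ht (DistTri.of_isZero₁ (isZero_zero D) (Iso.refl E.obj))
    inferInstance E.property, eulerClass_of_isZero t (isZero_zero D), zero_add]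

/-- With `H` the top cohomology of `W`, the octahedral axiom gives an extension `V` of `B` by `H` in
the heart, and the previous lemma applies to `U`, `X`, `V`. -/
theorem eulerClass_eq_add_heart' (ht : IsBoundedTStructure t) {W X B : D} (h : DistTri W X B)
    (hW : t.IsLE W 0) (hB : t.heart B) :
    eulerClass t X = eulerClass t W + abCls (⟨B, hB⟩ : t.heart.FullSubcategory) := by
  obtain ⟨U, H, hU, hH, hT⟩ := exists_distTri_heart t W hW
  obtain ⟨V, hV, hV'⟩ := hT.comp_left h
  have hB' := (t.mem_heart_iff _).1 hB
  have hH' := (t.mem_heart_iff _).1 hH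
  have hVh : t.heart V := (t.mem_heart_iff _).2
    ⟨hV'.isLE₂ t 0 hH'.1 hB'.1, hV'.isGE₂ t 0 hH'.2 hB'.2⟩
  obtain ⟨_, _, _, hS⟩ := heart_shortExact t (X := ⟨H, hH⟩) (Y := ⟨V, hVh⟩) (Z := ⟨B, hB⟩) hV'
  have := abCls_shortExact hS
  dsimp only at this
  rw [eulerClass_eq_add_heart ht hV hU hVh, eulerClass_eq_add_heart ht hT hU hH, this, add_assoc]

theorem eulerClass_shift_neg_one (X : D) : eulerClass t (X⟦(-1 : ℤ)⟧) = - eulerClass t X := by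
  rw [eulerClass_shift, Int.negOnePow_neg, Int.negOnePow_one, Units.neg_smul, one_smul]

variable (t) in
/-- Additivity of the Euler class on the triangles of objects `≤ 0` with given lower bounds. -/
def EulerAdditive (a b c : ℤ) : Prop :=
  ∀ X Y Z : D, DistTri X Y Z → t.IsLE X 0 → t.IsLE Y 0 → t.IsLE Z 0 →
    t.IsGE X a → t.IsGE Y b → t.IsGE Z c → eulerClass t Y = eulerClass t X + eulerClass t Z

/-- Removing the top cohomology `H` from both `Z` and `Y` changes the two Euler classes equally and
leaves a triangle on `X`, `Y'`, `Z'`. As `Z'` is now in degrees `≤ -1`, the rotated triangle on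
`Z'⟦-1⟧`, `X`, `Y'` is still in degrees `≤ 0`, with a better lower bound on its first vertex. -/
theorem EulerAdditive.of_rotate (ht : IsBoundedTStructure t) {a b c : ℤ} (hb : b ≤ 1) (hc : c ≤ 1)
    (h : EulerAdditive t (c + 1) a b) : EulerAdditive t a b c := by
  intro X Y Z hT hX hY hZ hX' hY' hZ'
  obtain ⟨Z', H, hZ₁, hH, hT₁⟩ := exists_distTri_heart t Z hZ
  obtain ⟨Y', hY₁, hT₂⟩ := hT.comp_right hT₁
  have hH' := ((t.mem_heart_iff _).1 hH).2
  have hZ₂ : t.IsLE Z' 0 := t.isLE_of_le Z' (-1) 0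
  have hY₂ : t.IsLE Y' 0 := hT₂.isLE₂ t 0 hX hZ₂
  have e₁ := eulerClass_eq_add_heart' ht hY₁ hY₂ hH
  have e₂ := eulerClass_eq_add_heart' ht hT₁ hZ₂ hH
  have e₃ := h _ _ _ hT₂.invRotate (t.isLE_shift Z' (-1) (-1) 0) hX hY₂
    (by
      have : t.IsGE Z' c := hT₁.isGE₁ t c hZ' (t.isGE_of_ge H (c - 1) 0)
      exact t.isGE_shift Z' c (-1) (c + 1)) hX'
    (hY₁.isGE₁ t b hY' (t.isGE_of_ge H (b - 1) 0))
  rw [eulerClass_shift_neg_one] at e₃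
  rw [e₁, e₂, e₃]
  abel

theorem eulerAdditive (ht : IsBoundedTStructure t) (n : ℕ) :
    EulerAdditive t (1 - n) (1 - n) (1 - n) := by
  induction n with
  | zero =>
    intro X Y Z _ hX hY hZ hX' hY' hZ'
    rw [eulerClass_of_isZero t (t.isZero X 0 (1 - (0 : ℕ)) (by lia)),
      eulerClass_of_isZero t (t.isZero Y 0 (1 - (0 : ℕ)) (by lia)),
      eulerClass_of_isZero t (t.isZero Z 0 (1 - (0 : ℕ)) (by lia)), zero_add]
  | succ n ih =>
    have e : (1 - ((n : ℕ) : ℤ)) = 1 - ((n + 1 : ℕ) : ℤ) + 1 := by push_cast; ring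
    rw [e] at ih
    -- Three rotations bring each vertex once to the third place, so every lower bound rises by one.
    exact .of_rotate ht (by lia) (by lia)
      (.of_rotate ht (by lia) (by lia) (.of_rotate ht (by lia) (by lia) ih))

theorem DistTri.eulerClass (ht : IsBoundedTStructure t) {X Y Z : D} (h : DistTri X Y Z) :
    eulerClass t Y = eulerClass t X + eulerClass t Z := by
  obtain ⟨a₁, b₁, ha₁, hb₁⟩ := ht X
  obtain ⟨a₂, b₂, ha₂, hb₂⟩ := ht Y
  obtain ⟨a₃, b₃, ha₃, hb₃⟩ := ht Z
  have ha₁ : t.IsGE X a₁ := ⟨ha₁⟩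
  have ha₂ : t.IsGE Y a₂ := ⟨ha₂⟩
  have ha₃ : t.IsGE Z a₃ := ⟨ha₃⟩
  have hb₁ : t.IsLE X b₁ := ⟨hb₁⟩
  have hb₂ : t.IsLE Y b₂ := ⟨hb₂⟩
  have hb₃ : t.IsLE Z b₃ := ⟨hb₃⟩
  -- The shift by `m` moves the triangle into degrees `≤ 0` and multiplies all three Euler classes
  -- by the same sign; `n` is large enough for all the lower bounds.
  obtain ⟨m, hm₁, hm₂, hm₃⟩ : ∃ m : ℤ, b₁ ≤ m ∧ b₂ ≤ m ∧ b₃ ≤ m :=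
    ⟨max b₁ (max b₂ b₃), by simp, by simp, by simp⟩
  obtain ⟨n, hn₁, hn₂, hn₃⟩ : ∃ n : ℕ, 1 - (n : ℤ) + m ≤ a₁ ∧ 1 - (n : ℤ) + m ≤ a₂ ∧
      1 - (n : ℤ) + m ≤ a₃ :=
    ⟨(max (1 + m - a₁) (max (1 + m - a₂) (1 + m - a₃))).toNat, by lia, by lia, by lia⟩
  have le (W : D) (b : ℤ) (hb : b ≤ m) (hW : t.IsLE W b) : t.IsLE (W⟦m⟧) 0 := by
    have := t.isLE_of_le W b m
    exact t.isLE_shift W m m 0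
  have ge (W : D) (a : ℤ) (ha : 1 - (n : ℤ) + m ≤ a) (hW : t.IsGE W a) :
      t.IsGE (W⟦m⟧) (1 - (n : ℤ)) := by
    have := t.isGE_of_ge W (1 - n + m) a
    exact t.isGE_shift W (1 - n + m) m (1 - n)
  have := eulerAdditive ht n _ _ _ (h.shift m) (le _ _ hm₁ hb₁) (le _ _ hm₂ hb₂) (le _ _ hm₃ hb₃)
    (ge _ _ hn₁ ha₁) (ge _ _ hn₂ ha₂) (ge _ _ hn₃ ha₃)
  rw [eulerClass_shift, eulerClass_shift, eulerClass_shift, ← smul_add] at this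
  exact (MulAction.injective m.negOnePow this :)

variable (t) in
/-- The homomorphism of Grothendieck groups induced by the inclusion of the heart. -/
noncomputable def heartToTriK₀ : AbK₀ t.heart.FullSubcategory →+ TriK₀ D :=
  abLift (fun E => triCls E.obj) fun _ hS => (heart_distTri t hS).triCls

theorem heartToTriK₀_abCls (E : t.heart.FullSubcategory) :
    heartToTriK₀ t (abCls E) = triCls E.obj :=
  abLift_abCls _ _ _

/-- The top cohomology is split off and the rest shifted back into degrees `≤ 0`, where it has
smaller amplitude; the shift only changes the sign of the class. -/
theorem triCls_mem_range_of_isLE (X : D) (n : ℕ) (hX : t.IsLE X 0) (hX' : t.IsGE X (1 - n)) :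
    triCls X ∈ (heartToTriK₀ t).range := by
  induction n generalizing X with
  | zero =>
    rw [triCls_of_isZero (t.isZero X 0 (1 - (0 : ℕ)) (by lia))]
    exact zero_mem _
  | succ n ih =>
    obtain ⟨U, H, hU, hH, hT⟩ := exists_distTri_heart t X hX
    have hH' := ((t.mem_heart_iff _).1 hH).2
    have := hT.isGE₁ t _ hX' (t.isGE_of_ge H _ 0)
    have hU' := ih (U⟦(-1 : ℤ)⟧) (t.isLE_shift U (-1) (-1) 0)
      (t.isGE_shift U (1 - (n + 1 : ℕ)) (-1) (1 - n))
    have h₁ : (Int.negOnePow (-1)) = -1 := by rw [Int.negOnePow_neg, Int.negOnePow_one]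
    rw [triCls_shift, h₁, Units.neg_smul, one_smul, neg_mem_iff] at hU'
    rw [hT.triCls]
    exact add_mem hU' ⟨_, heartToTriK₀_abCls ⟨H, hH⟩⟩

theorem triCls_mem_range (ht : IsBoundedTStructure t) (X : D) :
    triCls X ∈ (heartToTriK₀ t).range := by
  obtain ⟨a, b, ha, hb⟩ := ht X
  have ha : t.IsGE X a := ⟨ha⟩
  have hb : t.IsLE X b := ⟨hb⟩
  have h₁ := t.isGE_of_ge X (1 - ((1 + b - a).toNat : ℤ) + b) a
  have h := triCls_mem_range_of_isLE (t := t) (X⟦b⟧) (1 + b - a).toNat (t.isLE_shift X b b 0)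
    (t.isGE_shift X (1 - ((1 + b - a).toNat : ℤ) + b) b _ (by lia))
  rw [triCls_shift] at h
  obtain e | e := Int.units_eq_one_or b.negOnePow
  · simpa [e] using h
  · rw [e, Units.neg_smul, one_smul, neg_mem_iff] at h
    exact h

/-- The inclusion of the heart of a bounded t-structure induces an isomorphism of Grothendieck
groups. -/
noncomputable def heartK₀Equiv (ht : IsBoundedTStructure t) :
    AbK₀ t.heart.FullSubcategory ≃+ TriK₀ D :=
  AddEquiv.ofBijective (heartToTriK₀ t) (by
    constructor
    -- Injectivity: the Euler class induces a left inverse.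
    · have : (triLift (eulerClass t) fun _ _ _ h => h.eulerClass ht).comp (heartToTriK₀ t) =
          AddMonoidHom.id _ := abK₀_hom_ext fun E => by
        rw [AddMonoidHom.comp_apply, heartToTriK₀_abCls, triLift_triCls, eulerClass_heart ht]
        rfl
      exact Function.LeftInverse.injective (DFunLike.congr_fun this)
    · rw [← AddMonoidHom.range_eq_top, eq_top_iff]
      rintro x -
      induction x using QuotientAddGroup.induction_on with | _ x
      induction x using FreeAbelianGroup.induction_on with
      | zero => exact zero_mem _
      | of X => exact triCls_mem_range ht X
      | neg X h => exact neg_mem h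
      | add x y hx hy => exact add_mem hx hy)

theorem heartK₀Equiv_abCls (ht : IsBoundedTStructure t) (E : t.heart.FullSubcategory) :
    heartK₀Equiv ht (abCls E) = triCls E.obj :=
  heartToTriK₀_abCls E

end EulerClass

/-! ### Arguments in the half-open upper half plane -/

section UpperHalfPlane

/-- The union of the open upper half plane and the negative real axis. -/
def IsUpper (z : ℂ) : Prop := 0 < z.im ∨ (z.im = 0 ∧ z.re < 0)

theorem IsUpper.add {z w : ℂ} (hz : IsUpper z) (hw : IsUpper w) : IsUpper (z + w) := by
  simp only [IsUpper, Complex.add_im, Complex.add_re] at *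
  obtain hz | ⟨hz, hz'⟩ := hz <;> obtain hw | ⟨hw, hw'⟩ := hw
  · exact .inl (by linarith)
  · exact .inl (by linarith)
  · exact .inl (by linarith)
  · exact .inr ⟨by linarith, by linarith⟩

theorem IsUpper.ne_zero {z : ℂ} (hz : IsUpper z) : z ≠ 0 := by
  rintro rfl
  simp [IsUpper] at hz

theorem IsUpper.arg_pos {z : ℂ} (hz : IsUpper z) : 0 < z.arg := by
  obtain h | ⟨h, h'⟩ := hz
  · exact (Complex.arg_nonneg_iff.2 h.le).lt_of_ne' fun h₀ => h.ne' (Complex.arg_eq_zero_iff.1 h₀).2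
  · rw [Complex.arg_eq_pi_iff.2 ⟨h', h⟩]
    exact Real.pi_pos

theorem ray_eq (m φ : ℝ) : (m : ℂ) * Complex.exp (Complex.I * Real.pi * φ) =
    m * (Real.cos (Real.pi * φ) + Real.sin (Real.pi * φ) * Complex.I) := by
  rw [show Complex.I * Real.pi * φ = ((Real.pi * φ : ℝ) : ℂ) * Complex.I by push_cast; ring,
    Complex.exp_mul_I, Complex.ofReal_cos, Complex.ofReal_sin]

theorem arg_ray {m φ : ℝ} (hm : 0 < m) (hφ : φ ∈ Set.Ioc (0 : ℝ) 1) :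
    ((m : ℂ) * Complex.exp (Complex.I * Real.pi * φ)).arg = Real.pi * φ := by
  rw [ray_eq, Complex.ofReal_cos, Complex.ofReal_sin]
  refine Complex.arg_mul_cos_add_sin_mul_I hm ⟨?_, ?_⟩
  · nlinarith [Real.pi_pos, hφ.1]
  · nlinarith [Real.pi_pos, hφ.2]

theorem isUpper_ray {m φ : ℝ} (hm : 0 < m) (hφ : φ ∈ Set.Ioc (0 : ℝ) 1) :
    IsUpper ((m : ℂ) * Complex.exp (Complex.I * Real.pi * φ)) := by
  have him : ((m : ℂ) * Complex.exp (Complex.I * Real.pi * φ)).im =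
      m * Real.sin (Real.pi * φ) := by
    rw [ray_eq]
    generalize Real.pi * φ = x
    simp [-Complex.ofReal_cos, -Complex.ofReal_sin]
  have hre : ((m : ℂ) * Complex.exp (Complex.I * Real.pi * φ)).re =
      m * Real.cos (Real.pi * φ) := by
    rw [ray_eq]
    generalize Real.pi * φ = x
    simp [-Complex.ofReal_cos, -Complex.ofReal_sin]
  rw [IsUpper, him, hre]
  obtain h | rfl := hφ.2.lt_or_eq
  · exact .inl (mul_pos hm (Real.sin_pos_of_pos_of_lt_pi (mul_pos Real.pi_pos hφ.1)
      (by nlinarith [Real.pi_pos])))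
  · right
    simp [hm]

theorem IsUpper.eq_ray {z : ℂ} (hz : IsUpper z) : 0 < ‖z‖ ∧ z.arg / Real.pi ∈ Set.Ioc (0 : ℝ) 1 ∧
    z = (‖z‖ : ℂ) * Complex.exp (Complex.I * Real.pi * ((z.arg / Real.pi : ℝ) : ℂ)) := by
  refine ⟨norm_pos_iff.2 hz.ne_zero, ⟨div_pos hz.arg_pos Real.pi_pos,
    (div_le_one Real.pi_pos).2 (Complex.arg_le_pi z)⟩, ?_⟩
  have : Complex.I * Real.pi * ((z.arg / Real.pi : ℝ) : ℂ) = z.arg * Complex.I := by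
    have : (Real.pi : ℂ) ≠ 0 := by exact_mod_cast Real.pi_ne_zero
    push_cast
    field_simp
  rw [this, Complex.norm_mul_exp_arg_mul_I]

/-- The determinant of `z` and `w` is `‖z‖ ‖w‖ sin (arg w - arg z)`. Both arguments lie in `(0, π]`,
so their difference is in `(-π, π)`, where the sine has the sign of its argument. -/
theorem IsUpper.arg_le_arg_iff {z w : ℂ} (hz : IsUpper z) (hw : IsUpper w) :
    z.arg ≤ w.arg ↔ 0 ≤ z.re * w.im - z.im * w.re := by
  have e : z.re * w.im - z.im * w.re = ‖z‖ * ‖w‖ * Real.sin (w.arg - z.arg) := by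
    rw [Real.sin_sub]
    linear_combination (- w.im) * Complex.norm_mul_cos_arg z -
      ‖z‖ * Real.cos z.arg * Complex.norm_mul_sin_arg w +
      w.re * Complex.norm_mul_sin_arg z + ‖z‖ * Real.sin z.arg * Complex.norm_mul_cos_arg w
  have hpos : 0 < ‖z‖ * ‖w‖ := mul_pos (norm_pos_iff.2 hz.ne_zero) (norm_pos_iff.2 hw.ne_zero)
  have h₁ := hz.arg_pos
  have h₂ := hw.arg_pos
  have h₃ := Complex.arg_le_pi z
  have h₄ := Complex.arg_le_pi w
  rw [e]
  constructor
  · intro h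
    exact mul_nonneg hpos.le (Real.sin_nonneg_of_nonneg_of_le_pi (by linarith) (by linarith))
  · intro h
    by_contra hlt
    have := Real.sin_neg_of_neg_of_neg_pi_lt (x := w.arg - z.arg) (by linarith) (by linarith)
    exact absurd h (not_le.2 (mul_neg_of_pos_of_neg hpos this))

/-- The determinant of `z` with itself vanishes, so adding `z` to `w` does not change it. This is
the see-saw property of phases. -/
theorem IsUpper.arg_le_arg_add_iff {z w : ℂ} (hz : IsUpper z) (hw : IsUpper w) :
    z.arg ≤ (z + w).arg ↔ z.arg ≤ w.arg := by
  rw [hz.arg_le_arg_iff (hz.add hw), hz.arg_le_arg_iff hw]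
  simp only [Complex.add_im, Complex.add_re]
  ring_nf

theorem IsUpper.arg_add_le_arg_iff {z w : ℂ} (hz : IsUpper z) (hw : IsUpper w) :
    (z + w).arg ≤ w.arg ↔ z.arg ≤ w.arg := by
  rw [(hz.add hw).arg_le_arg_iff hw, hz.arg_le_arg_iff hw]
  simp only [Complex.add_im, Complex.add_re]
  ring_nf

theorem IsUpper.arg_add_le {z w : ℂ} (hz : IsUpper z) (hw : IsUpper w) {θ : ℝ} (h₁ : z.arg ≤ θ)
    (h₂ : w.arg ≤ θ) : (z + w).arg ≤ θ := by
  obtain h | h := le_total z.arg w.arg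
  · exact ((hz.arg_add_le_arg_iff hw).2 h).trans h₂
  · rw [add_comm]
    exact ((hw.arg_add_le_arg_iff hz).2 h).trans h₁

theorem IsUpper.lt_arg_add {z w : ℂ} (hz : IsUpper z) (hw : IsUpper w) {θ : ℝ} (h₁ : θ < z.arg)
    (h₂ : θ < w.arg) : θ < (z + w).arg := by
  obtain h | h := le_total z.arg w.arg
  · exact h₁.trans_le ((hz.arg_le_arg_add_iff hw).2 h)
  · rw [add_comm]
    exact h₂.trans_le ((hw.arg_le_arg_add_iff hz).2 h)

end UpperHalfPlane

/-! ### Phases and semistable objects -/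

section Semistable

variable {A : Type u} [Category.{v} A] [Abelian A] {Z : AbK₀ A →+ ℂ}

theorem isStabilityFunction_iff :
    IsStabilityFunction Z ↔ ∀ E : A, ¬ IsZero E → IsUpper (Z (abCls E)) := by
  refine forall₂_congr fun E _ => ⟨?_, fun h => ⟨_, _, h.eq_ray⟩⟩
  rintro ⟨m, φ, hm, hφ, h⟩
  rw [h]
  exact isUpper_ray hm hφ

theorem phase_iso {E F : A} (e : E ≅ F) : phase Z E = phase Z F := by
  rw [phase, phase, abCls_iso e]

theorem phase_le_phase_iff {E F : A} :
    phase Z E ≤ phase Z F ↔ (Z (abCls E)).arg ≤ (Z (abCls F)).arg :=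
  div_le_div_iff_of_pos_right Real.pi_pos

theorem phase_mem (hZ : IsStabilityFunction Z) {E : A} (hE : ¬ IsZero E) :
    phase Z E ∈ Set.Ioc (0 : ℝ) 1 :=
  (isStabilityFunction_iff.1 hZ E hE).eq_ray.2.1

theorem charge_eq (hZ : IsStabilityFunction Z) {E : A} (hE : ¬ IsZero E) :
    ∃ m : ℝ, 0 < m ∧ Z (abCls E) = (m : ℂ) * Complex.exp (Complex.I * Real.pi * phase Z E) :=
  ⟨_, (isStabilityFunction_iff.1 hZ E hE).eq_ray.1, (isStabilityFunction_iff.1 hZ E hE).eq_ray.2.2⟩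

theorem phase_eq_of_charge {E : A} {m φ : ℝ} (hm : 0 < m) (hφ : φ ∈ Set.Ioc (0 : ℝ) 1)
    (h : Z (abCls E) = (m : ℂ) * Complex.exp (Complex.I * Real.pi * φ)) : phase Z E = φ := by
  rw [phase, h, arg_ray hm hφ, mul_div_cancel_left₀ _ Real.pi_ne_zero]

theorem phase_left_le_mid_iff (hZ : IsStabilityFunction Z) {S : ShortComplex A} (hS : S.ShortExact)
    (h₁ : ¬ IsZero S.X₁) (h₃ : ¬ IsZero S.X₃) :
    phase Z S.X₁ ≤ phase Z S.X₂ ↔ phase Z S.X₁ ≤ phase Z S.X₃ := by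
  rw [isStabilityFunction_iff] at hZ
  rw [phase_le_phase_iff, phase_le_phase_iff, abCls_shortExact hS, map_add,
    (hZ _ h₁).arg_le_arg_add_iff (hZ _ h₃)]

theorem phase_mid_le_right_iff (hZ : IsStabilityFunction Z) {S : ShortComplex A}
    (hS : S.ShortExact) (h₁ : ¬ IsZero S.X₁) (h₃ : ¬ IsZero S.X₃) :
    phase Z S.X₂ ≤ phase Z S.X₃ ↔ phase Z S.X₁ ≤ phase Z S.X₃ := by
  rw [isStabilityFunction_iff] at hZ
  rw [phase_le_phase_iff, phase_le_phase_iff, abCls_shortExact hS, map_add,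
    (hZ _ h₁).arg_add_le_arg_iff (hZ _ h₃)]

theorem ShortExact.nonempty_iso_right {S : ShortComplex A} (hS : S.ShortExact)
    (h : IsZero S.X₁) : Nonempty (S.X₂ ≅ S.X₃) := by
  have := hS.isIso_g_iff.2 h
  exact ⟨asIso S.g⟩

theorem ShortExact.nonempty_iso_left {S : ShortComplex A} (hS : S.ShortExact)
    (h : IsZero S.X₃) : Nonempty (S.X₁ ≅ S.X₂) := by
  have := hS.isIso_f_iff.2 h
  exact ⟨asIso S.f⟩

/-- The bounds on the outer terms are conditional because the phase of a zero object is a default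
value. -/
theorem phase_mid_le (hZ : IsStabilityFunction Z) {S : ShortComplex A}
    (hS : S.ShortExact) {φ : ℝ} (h₁ : ¬ IsZero S.X₁ → phase Z S.X₁ ≤ φ)
    (h₃ : ¬ IsZero S.X₃ → phase Z S.X₃ ≤ φ) (h₂ : ¬ IsZero S.X₂) : phase Z S.X₂ ≤ φ := by
  by_cases z₁ : IsZero S.X₁
  · obtain ⟨e⟩ := ShortExact.nonempty_iso_right hS z₁
    rw [phase_iso e]
    exact h₃ fun h => h₂ (h.of_iso e)
  by_cases z₃ : IsZero S.X₃
  · obtain ⟨e⟩ := ShortExact.nonempty_iso_left hS z₃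
    rw [← phase_iso e]
    exact h₁ z₁
  obtain h | h := le_total (phase Z S.X₁) (phase Z S.X₃)
  · exact ((phase_mid_le_right_iff hZ hS z₁ z₃).2 h).trans (h₃ z₃)
  · refine le_trans ?_ (h₁ z₁)
    by_contra hlt
    have h' := (phase_left_le_mid_iff hZ hS z₁ z₃).1 (not_le.1 hlt).le
    have := (phase_mid_le_right_iff hZ hS z₁ z₃).2 h'
    linarith [not_le.1 hlt]

theorem shortExact_of_mono {X Y : A} (f : X ⟶ Y) [Mono f] :
    (ShortComplex.mk f (cokernel.π f) (cokernel.condition f)).ShortExact where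
  exact := ShortComplex.exact_cokernel f

theorem shortExact_of_epi {X Y : A} (f : X ⟶ Y) [Epi f] :
    (ShortComplex.mk (kernel.ι f) f (kernel.condition f)).ShortExact where
  exact := ShortComplex.exact_kernel f

theorem shortExact_kernel_image {X Y : A} (f : X ⟶ Y) :
    (ShortComplex.mk (kernel.ι f) (factorThruImage f) (by
      rw [← cancel_mono (image.ι f), Category.assoc, image.fac, kernel.condition,
        Limits.zero_comp])).ShortExact where
  exact := by
    refine ShortComplex.exact_of_f_is_kernel _ ?_
    refine isKernelOfComp (f := factorThruImage f) (image.ι f) f (kernelIsKernel f) _ (image.fac f)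

theorem IsSemistable.phase_le_of_mono {E F : A} (hE : IsSemistable Z E) (f : F ⟶ E) [Mono f]
    (hF : ¬ IsZero F) : phase Z F ≤ phase Z E := by
  have e := Subobject.underlyingIso f
  rw [← phase_iso e]
  exact hE.2 _ fun h => hF (h.of_iso e.symm)

theorem isSemistable_of_mono {E : A} (hE : ¬ IsZero E)
    (h : ∀ (F : A) (f : F ⟶ E), Mono f → ¬ IsZero F → phase Z F ≤ phase Z E) : IsSemistable Z E :=
  ⟨hE, fun F hF => h _ F.arrow inferInstance hF⟩

theorem IsSemistable.of_iso {E F : A} (hE : IsSemistable Z E) (e : E ≅ F) : IsSemistable Z F :=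
  isSemistable_of_mono (fun h => hE.1 (h.of_iso e)) fun G f _ hG => by
    rw [← phase_iso e]
    exact hE.phase_le_of_mono (f ≫ e.inv) hG

theorem IsSemistable.phase_le_of_epi (hZ : IsStabilityFunction Z) {E F : A}
    (hE : IsSemistable Z E) (f : E ⟶ F) [Epi f] (hF : ¬ IsZero F) : phase Z E ≤ phase Z F := by
  have hS := shortExact_of_epi f
  by_cases hK : IsZero (kernel f)
  · obtain ⟨e⟩ := ShortExact.nonempty_iso_right hS hK
    exact (phase_iso e).le
  · exact (phase_mid_le_right_iff hZ hS hK hF).2 ((phase_left_le_mid_iff hZ hS hK hF).1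
      (hE.phase_le_of_mono (kernel.ι f) hK))

/-- A nonzero image would be a quotient of `E` and a subobject of `F`, forcing `phase Z E ≤ phase Z
F`. -/
theorem IsSemistable.hom_eq_zero (hZ : IsStabilityFunction Z) {E F : A}
    (hE : IsSemistable Z E) (hF : IsSemistable Z F) (h : phase Z F < phase Z E) (f : E ⟶ F) :
    f = 0 := by
  by_cases hI : IsZero (Limits.image f)
  · rw [← image.fac f, hI.eq_of_src (image.ι f) 0, Limits.comp_zero]
  · have h₁ := hE.phase_le_of_epi hZ (factorThruImage f) hI
    have h₂ := hF.phase_le_of_mono (image.ι f) hI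
    linarith

/-- A subobject `G` of the middle term is an extension of its image in `S.X₃` by a subobject of
`S.X₁`, and both have phase at most `φ` when nonzero. -/
theorem IsSemistable.of_shortExact (hZ : IsStabilityFunction Z) {S : ShortComplex A}
    (hS : S.ShortExact) {φ : ℝ} (h₁ : IsSemistable Z S.X₁) (h₃ : IsSemistable Z S.X₃)
    (h₁' : phase Z S.X₁ = φ) (h₃' : phase Z S.X₃ = φ) :
    IsSemistable Z S.X₂ ∧ phase Z S.X₂ = φ := by
  have := hS.mono_f
  have h₀ : ¬ IsZero S.X₂ := fun h => h₁.1 (IsZero.of_mono_eq_zero S.f (h.eq_of_tgt _ _))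
  have hφ : phase Z S.X₂ = φ := by
    apply le_antisymm
    · rw [← h₃']
      exact (phase_mid_le_right_iff hZ hS h₁.1 h₃.1).2 (h₁'.trans h₃'.symm).le
    · rw [← h₁']
      exact (phase_left_le_mid_iff hZ hS h₁.1 h₃.1).2 (h₁'.trans h₃'.symm).le
  refine ⟨isSemistable_of_mono h₀ fun G f _ hG => ?_, hφ⟩
  rw [hφ]
  refine phase_mid_le hZ (shortExact_kernel_image (f ≫ S.g)) (fun hK => ?_) (fun hI => ?_) hG
  · let k : kernel (f ≫ S.g) ⟶ S.X₁ := hS.exact.lift (kernel.ι (f ≫ S.g) ≫ f) (by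
      rw [Category.assoc, kernel.condition])
    have hk : k ≫ S.f = kernel.ι (f ≫ S.g) ≫ f := hS.exact.lift_f _ _
    have : Mono (k ≫ S.f) := by rw [hk]; infer_instance
    have : Mono k := mono_of_mono k S.f
    rw [← h₁']
    exact h₁.phase_le_of_mono k hK
  · rw [← h₃']
    exact h₃.phase_le_of_mono (image.ι (f ≫ S.g)) hI

end Semistable

/-! ### Dévissage in extension closures -/

section ExtClosure

variable {D : Type u} [Category.{v} D] [Preadditive D] [HasZeroObject D] [HasShift D ℤ]
  [∀ n : ℤ, (shiftFunctor D n).Additive] [Pretriangulated D]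

theorem ExtClosure.of_distTri {Q : ObjectProperty D} {X Y Z : D} (h : DistTri X Y Z)
    (hX : ExtClosure Q X) (hZ : ExtClosure Q Z) : ExtClosure Q Y := by
  obtain ⟨f, g, h, hT⟩ := h
  exact .ext _ _ _ f g h hT hX hZ

theorem ExtClosure.of_iso {Q : ObjectProperty D} {X Y : D} (hX : ExtClosure Q X) (e : X ≅ Y) :
    ExtClosure Q Y :=
  .of_distTri (.of_isZero₃ (isZero_zero D) e) hX (.zero _ (isZero_zero D))

theorem ExtClosure.induction {Q R : ObjectProperty D} (h : ∀ X, Q X → R X)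
    (h₀ : ∀ X, IsZero X → R X) (he : ∀ X Y Z : D, DistTri X Y Z → R X → R Z → R Y) {X : D}
    (hX : ExtClosure Q X) : R X := by
  induction hX with
  | of X hX => exact h X hX
  | zero X hX => exact h₀ X hX
  | ext X Y Z f g h hT _ _ hX hZ => exact he _ _ _ ⟨f, g, h, hT⟩ hX hZ

theorem ExtClosure.mono {Q R : ObjectProperty D} (h : ∀ X, Q X → R X) {X : D}
    (hX : ExtClosure Q X) : ExtClosure R X :=
  hX.induction (fun X hX => .of X (h X hX)) .zero fun _ _ _ => .of_distTri

theorem ExtClosure.hom_eq_zero {Q R : ObjectProperty D}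
    (h : ∀ X Y, Q X → R Y → ∀ f : X ⟶ Y, f = 0) {X Y : D} (hX : ExtClosure Q X)
    (hY : ExtClosure R Y) (f : X ⟶ Y) : f = 0 := by
  revert f
  refine hX.induction (R := fun X => ∀ f : X ⟶ Y, f = 0) (fun X hX => ?_)
    (fun X hX f => hX.eq_of_src _ _) fun _ _ _ hT h₁ h₃ => hT.zero_hom_of h₁ h₃
  exact hY.induction (R := fun Y => ∀ f : X ⟶ Y, f = 0) (fun Y hY => h X Y hX hY)
    (fun Y hY f => hY.eq_of_tgt _ _) fun _ _ _ hT h₁ h₃ => hT.hom_zero_of h₁ h₃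

end ExtClosure

/-! ### Harder–Narasimhan towers as inductive filtrations -/

section HNFiltration

variable {D : Type u} [Category.{v} D] [Preadditive D] [HasZeroObject D] [HasShift D ℤ]
  [∀ n : ℤ, (shiftFunctor D n).Additive] [Pretriangulated D] {P : ℝ → ObjectProperty D}

/-- `X` is an iterated extension of nonzero objects of the `P φ` for the given list of phases,
from the smallest to the largest. -/
inductive HNFiltered (P : ℝ → ObjectProperty D) : List ℝ → D → Prop
  | nil (X : D) (hX : IsZero X) : HNFiltered P [] X
  | cons (E X A : D) (φ : ℝ) (l : List ℝ) (hT : DistTri E X A) (hA : P φ A) (hA₀ : ¬ IsZero A)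
      (hφ : ∀ ψ ∈ l, φ < ψ) (hE : HNFiltered P l E) : HNFiltered P (φ :: l) X

theorem HNFiltered.of_iso {l : List ℝ} {X Y : D} (hX : HNFiltered P l X) (e : X ≅ Y) :
    HNFiltered P l Y := by
  cases hX with
  | nil _ hX => exact .nil _ (hX.of_iso e.symm)
  | cons E _ A φ l hT hA hA₀ hφ hE =>
    exact .cons E _ A φ l (hT.of_iso (Iso.refl _) e (Iso.refl _)) hA hA₀ hφ hE

/-- Towers may have zero factors, which `HNFiltered` forbids; such a factor changes the object only
up to isomorphism, so its phase is dropped. -/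
theorem HNFiltered.extend {l : List ℝ} {E X A : D} {φ : ℝ} (hE : HNFiltered P l E)
    (hT : DistTri E X A) (hA : P φ A) (hφ : ∀ ψ ∈ l, φ < ψ) :
    ∃ l', HNFiltered P l' X ∧ ∀ ψ ∈ l', ψ = φ ∨ ψ ∈ l := by
  by_cases hA₀ : IsZero A
  · obtain ⟨e⟩ := hT.iso_of_isZero₃ hA₀
    exact ⟨l, hE.of_iso e, fun ψ hψ => .inr hψ⟩
  · exact ⟨φ :: l, .cons E X A φ l hT hA hA₀ hφ hE, fun ψ hψ => List.mem_cons.1 hψ⟩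

/-- By induction on the filtration of `A`: the octahedral axiom pulls its last stage `A'` back to a
stage `W` of `X`, an extension of `A'` by `E`. -/
theorem HNFiltered.append [IsTriangulated D] {l l' : List ℝ} {E X A : D} (hT : DistTri E X A)
    (hE : HNFiltered P l E) (hA : HNFiltered P l' A) (h : ∀ φ ∈ l', ∀ ψ ∈ l, φ < ψ) :
    HNFiltered P (l' ++ l) X := by
  induction hA generalizing X with
  | nil A hA =>
    obtain ⟨e⟩ := hT.iso_of_isZero₃ hA
    exact hE.of_iso e
  | cons A' A S φ l' hT' hS hS₀ hφ hA' ih =>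
    obtain ⟨W, hW, hW'⟩ := hT.comp_right hT'
    refine .cons W X S φ (l' ++ l) hW hS hS₀ (fun ψ hψ => ?_)
      (ih hW' fun φ hφ => h φ (List.mem_cons_of_mem _ hφ))
    obtain hψ | hψ := List.mem_append.1 hψ
    · exact hφ ψ hψ
    · exact h φ List.mem_cons_self ψ hψ

theorem HNFiltered.extClosure {l : List ℝ} {X : D} (hX : HNFiltered P l X) :
    ExtClosure (fun Y => ∃ φ ∈ l, P φ Y) X := by
  induction hX with
  | nil X hX => exact .zero X hX
  | cons E X A φ l hT hA hA₀ hφ hE ih =>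
    exact .of_distTri hT (ih.mono fun Y ⟨ψ, hψ, hY⟩ => ⟨ψ, List.mem_cons_of_mem _ hψ, hY⟩)
      (.of A ⟨φ, List.mem_cons_self, hA⟩)

/-- If the smallest phase exceeds `c`, all of `X` goes into `U`. Otherwise `E` is split, and the
octahedral axiom absorbs the last factor `A` into `V`. -/
theorem HNFiltered.split [IsTriangulated D] {l : List ℝ} {X : D} (hX : HNFiltered P l X) (c : ℝ) :
    ∃ U V : D, DistTri U X V ∧ ExtClosure (fun Y => ∃ φ ∈ l, c < φ ∧ P φ Y) U ∧
      ExtClosure (fun Y => ∃ φ ∈ l, φ ≤ c ∧ P φ Y) V := by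
  have h := hX
  induction hX with
  | nil X hX => exact ⟨X, X, .of_isZero₁ hX (Iso.refl _), .zero X hX, .zero X hX⟩
  | cons E X A φ l hT hA hA₀ hφ hE ih =>
    obtain hc | hc := lt_or_ge c φ
    · refine ⟨X, _, .of_isZero₃ (isZero_zero D) (Iso.refl _), ?_, .zero _ (isZero_zero D)⟩
      refine h.extClosure.mono fun Y ⟨ψ, hψ, hY⟩ => ⟨ψ, hψ, ?_, hY⟩
      obtain rfl | hψ := List.mem_cons.1 hψ
      · exact hc
      · exact hc.trans (hφ ψ hψ)
    · obtain ⟨U, V, hUV, hU, hV⟩ := ih hE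
      obtain ⟨W, hW, hW'⟩ := hUV.comp_left hT
      refine ⟨U, W, hW, hU.mono fun Y ⟨ψ, hψ, hY⟩ => ⟨ψ, List.mem_cons_of_mem _ hψ, hY⟩,
        .of_distTri hW' (hV.mono fun Y ⟨ψ, hψ, hY⟩ => ⟨ψ, List.mem_cons_of_mem _ hψ, hY⟩)
          (.of A ⟨φ, List.mem_cons_self, hc, hA⟩)⟩

theorem HNTower.exists_hnFiltered {X : D} (T : HNTower P X) :
    ∃ l, HNFiltered P l X := by
  have h : ∀ k : Fin (T.n + 1), ∃ l, HNFiltered P l (T.obj k) ∧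
      ∀ ψ ∈ l, ∃ j : Fin T.n, j.castSucc < k ∧ ψ = T.φ j := by
    intro k
    induction k using Fin.induction with
    | zero => exact ⟨[], .nil _ T.isZero_obj_zero, by simp⟩
    | succ j ih =>
      obtain ⟨l, hl, hl'⟩ := ih
      obtain ⟨l', hl₁, hl₂⟩ := hl.extend ⟨_, _, _, T.distinguished j⟩ (T.mem j) fun ψ hψ => by
        obtain ⟨i, hi, rfl⟩ := hl' ψ hψ
        exact T.strictAnti (Fin.castSucc_lt_castSucc_iff.1 hi)
      refine ⟨l', hl₁, fun ψ hψ => ?_⟩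
      obtain rfl | hψ := hl₂ ψ hψ
      · exact ⟨j, Fin.castSucc_lt_succ, rfl⟩
      · obtain ⟨i, hi, rfl⟩ := hl' ψ hψ
        exact ⟨i, hi.trans Fin.castSucc_lt_succ, rfl⟩
  obtain ⟨l, hl, -⟩ := h (Fin.last T.n)
  exact ⟨l, hl.of_iso T.isoLast⟩

theorem Fin.strictAnti_snoc {n : ℕ} {φ : Fin n → ℝ} (hφ : StrictAnti φ) {ψ : ℝ}
    (h : ∀ j, ψ < φ j) : StrictAnti (Fin.snoc (α := fun _ => ℝ) φ ψ) := by
  intro i j hij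
  induction j using Fin.lastCases with
  | last =>
    induction i using Fin.lastCases with
    | last => exact absurd hij (lt_irrefl _)
    | cast i => simpa using h i
  | cast j =>
    induction i using Fin.lastCases with
    | last => exact absurd hij (not_lt.2 (Fin.le_last _))
    | cast i => simpa using hφ (Fin.castSucc_lt_castSucc_iff.1 hij)

theorem HNFiltered.exists_tower {l : List ℝ} {X : D} (hX : HNFiltered P l X) :
    ∃ T : HNTower P X, ∀ j, T.φ j ∈ l := by
  induction hX with
  | nil X hX =>
    exact ⟨{ n := 0, φ := Fin.elim0, strictAnti := fun i => i.elim0, obj := fun _ => X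
             fac := Fin.elim0, f := fun j => j.elim0, g := fun j => j.elim0, h := fun j => j.elim0
             distinguished := fun j => j.elim0, isZero_obj_zero := hX, isoLast := Iso.refl _
             mem := fun j => j.elim0 }, fun j => j.elim0⟩
  | cons E X A φ l hT hA hA₀ hφ hE ih =>
    obtain ⟨T, hTl⟩ := ih
    let obj : Fin (T.n + 1 + 1) → D := Fin.snoc (α := fun _ => D) T.obj X
    let fac : Fin (T.n + 1) → D := Fin.snoc (α := fun _ => D) T.fac A
    let ψ : Fin (T.n + 1) → ℝ := Fin.snoc (α := fun _ => ℝ) T.φ φ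
    have hobj (j) : obj (Fin.castSucc j) = T.obj j := by simp [obj]
    have key : ∀ j : Fin (T.n + 1), DistTri (obj j.castSucc) (obj j.succ) (fac j) := by
      intro j
      induction j using Fin.lastCases with
      | last =>
        rw [hobj, show obj (Fin.last T.n).succ = X by simp [obj],
          show fac (Fin.last T.n) = A by simp [fac]]
        exact hT.of_iso T.isoLast.symm (Iso.refl _) (Iso.refl _)
      | cast j =>
        rw [hobj, ← Fin.castSucc_succ, hobj, show fac j.castSucc = T.fac j by simp [fac]]
        exact ⟨_, _, _, T.distinguished j⟩
    choose f g h hd using key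
    refine ⟨{ n := T.n + 1, φ := ψ
              strictAnti := Fin.strictAnti_snoc T.strictAnti fun j => hφ _ (hTl j)
              obj := obj, fac := fac, f := f, g := g, h := h, distinguished := hd
              isZero_obj_zero := ?_, isoLast := eqToIso (by simp [obj]), mem := ?_ }, ?_⟩
    · rw [← Fin.castSucc_zero, hobj]
      exact T.isZero_obj_zero
    · intro j
      induction j using Fin.lastCases with
      | last => simpa [fac, ψ] using hA
      | cast j => simpa [fac, ψ] using T.mem j
    · intro j
      induction j using Fin.lastCases with
      | last => simp [ψ]
      | cast j => simpa [ψ] using .inr (hTl j)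

end HNFiltration

/-! ### The t-structure of a stability condition -/

section HeartOfStabilityCondition

variable {D : Type u} [Category.{v} D] [Preadditive D] [HasZeroObject D] [HasShift D ℤ]
  [∀ n : ℤ, (shiftFunctor D n).Additive] [Pretriangulated D]

namespace StabilityCondition

variable (σ : StabilityCondition D)

theorem P_iso {φ : ℝ} {X Y : D} (h : σ.P φ X) (e : X ≅ Y) : σ.P φ Y :=
  σ.of_iso φ X Y ⟨e⟩ h

theorem P_shift_one {φ : ℝ} {X : D} (h : σ.P φ X) : σ.P (φ + 1) (X⟦(1 : ℤ)⟧) := by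
  rw [σ.shift]
  exact ⟨X, h, ⟨Iso.refl _⟩⟩

theorem P_shift_neg_one {φ : ℝ} {X : D} (h : σ.P φ X) : σ.P (φ - 1) (X⟦(-1 : ℤ)⟧) := by
  rw [← sub_add_cancel φ 1, σ.shift] at h
  obtain ⟨Y, hY, ⟨e⟩⟩ := h
  exact σ.P_iso hY ((shiftEquiv D (1 : ℤ)).unitIso.app Y ≪≫ (shiftFunctor D (-1 : ℤ)).mapIso e)

theorem P_shift {φ : ℝ} {X : D} (h : σ.P φ X) (n : ℤ) : σ.P (φ + n) (X⟦n⟧) := by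
  induction n using Int.induction_on with
  | zero => simpa using σ.P_iso h ((shiftFunctorZero D ℤ).app X).symm
  | succ n ih =>
    have := σ.P_iso (σ.P_shift_one ih) ((shiftFunctorAdd D (n : ℤ) 1).app X).symm
    push_cast at this ⊢
    rwa [← add_assoc]
  | pred n ih =>
    have := σ.P_iso (σ.P_shift_neg_one ih)
      ((shiftFunctorAdd' D (-n : ℤ) (-1) (-n - 1) (by lia)).app X).symm
    push_cast at this ⊢
    rwa [← add_sub_assoc]

theorem P_shift_iff {φ : ℝ} {X : D} (n : ℤ) : σ.P (φ + n) (X⟦n⟧) ↔ σ.P φ X := by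
  refine ⟨fun h => ?_, fun h => σ.P_shift h n⟩
  have := σ.P_iso (σ.P_shift h (-n)) ((shiftEquiv D n).unitIso.symm.app X)
  simpa using this

variable {σ}

theorem interval_mono {I J : Set ℝ} (h : I ⊆ J) {X : D} (hX : σ.interval I X) : σ.interval J X :=
  ExtClosure.mono (fun _ ⟨φ, hφ, hY⟩ => ⟨φ, h hφ, hY⟩) hX

theorem interval_iso {I : Set ℝ} {X Y : D} (hX : σ.interval I X) (e : X ≅ Y) : σ.interval I Y :=
  ExtClosure.of_iso hX e

theorem interval_hom_eq_zero {I J : Set ℝ} (h : ∀ φ ∈ I, ∀ ψ ∈ J, ψ < φ) {X Y : D}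
    (hX : σ.interval I X) (hY : σ.interval J Y) (f : X ⟶ Y) : f = 0 :=
  ExtClosure.hom_eq_zero (fun _ _ ⟨φ, hφ, hU⟩ ⟨ψ, hψ, hV⟩ =>
    σ.hom_eq_zero φ ψ (h φ hφ ψ hψ) _ _ hU hV) hX hY f

theorem interval_shift {I J : Set ℝ} (n : ℤ) (h : ∀ φ ∈ I, φ + n ∈ J) {X : D}
    (hX : σ.interval I X) : σ.interval J (X⟦n⟧) :=
  ExtClosure.induction (R := fun X => σ.interval J (X⟦n⟧))
    (fun _ ⟨φ, hφ, hY⟩ => .of _ ⟨φ + n, h φ hφ, σ.P_shift hY n⟩)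
    (fun _ hX => .zero _ (Functor.map_isZero (shiftFunctor D n) hX))
    (fun _ _ _ hT h₁ h₃ => .of_distTri (hT.shift n) h₁ h₃) hX

variable (σ) in
theorem exists_hnFiltered (X : D) : ∃ l, HNFiltered σ.P l X := by
  by_cases hX : IsZero X
  · exact ⟨[], .nil X hX⟩
  · obtain ⟨T⟩ := σ.exists_tower X hX
    exact T.exists_hnFiltered

theorem interval_of_hnFiltered {l : List ℝ} {X : D} (hX : HNFiltered σ.P l X) {I : Set ℝ}
    (h : ∀ φ ∈ l, φ ∈ I) : σ.interval I X :=
  hX.extClosure.mono fun _ ⟨φ, hφ, hY⟩ => ⟨φ, h φ hφ, hY⟩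

/-- All phases of an object of `P(> c)` are larger than `c`. -/
theorem lt_of_hnFiltered {l : List ℝ} {X : D} (hX : HNFiltered σ.P l X) {c : ℝ}
    (hc : σ.interval (Set.Ioi c) X) : ∀ φ ∈ l, c < φ := by
  cases hX with
  | nil X hX => simp
  | cons E X A φ l hT hA hA₀ hφ hE =>
    have key : c < φ := by
      by_contra hlt
      -- If `φ ≤ c`, neither `X`, with phases `> c`, nor `E⟦1⟧`, with phases `> φ + 1`, has nonzero
      -- maps to `A`, so `A` would vanish.
      refine hA₀ (hT.isZero₃_of_hom_zero (fun f => ?_) fun f => ?_)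
      · exact interval_hom_eq_zero (σ := σ) (J := {φ})
          (by rintro ψ hψ _ rfl; exact (not_lt.1 hlt).trans_lt hψ) hc (.of _ ⟨φ, rfl, hA⟩) f
      · refine interval_hom_eq_zero (σ := σ) (I := Set.Ioi (φ + 1)) (J := {φ})
          (by rintro ψ hψ _ rfl; exact (lt_add_one _).trans hψ)
          (interval_shift (I := Set.Ioi φ) 1 (by simp) (interval_of_hnFiltered hE hφ))
          (.of _ ⟨φ, rfl, hA⟩) f
    intro ψ hψ
    obtain rfl | hψ := List.mem_cons.1 hψ
    · exact key
    · exact key.trans (hφ ψ hψ)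

/-- All phases of an object of `P(≤ c)` are at most `c`. -/
theorem le_of_hnFiltered {l : List ℝ} {X : D} (hX : HNFiltered σ.P l X) {c : ℝ}
    (hc : σ.interval (Set.Iic c) X) : ∀ φ ∈ l, φ ≤ c := by
  have h := hX
  induction hX with
  | nil X hX => simp
  | cons E X A φ l hT hA hA₀ hφ hE ih =>
    have key : φ ≤ c := by
      by_contra hlt
      have h₁ : σ.interval (Set.Ioi c) X := interval_of_hnFiltered h fun ψ hψ => by
        obtain rfl | hψ := List.mem_cons.1 hψ
        · exact not_le.1 hlt
        · exact (not_le.1 hlt).trans (hφ ψ hψ)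
      have h₂ : IsZero X := (IsZero.iff_id_eq_zero X).2
        (interval_hom_eq_zero (fun a ha b hb => (Set.mem_Iic.1 hb).trans_lt ha) h₁ hc _)
      -- A zero object lies in `P(> φ)`, so the previous lemma gives `φ < φ`.
      exact lt_irrefl φ (lt_of_hnFiltered h (.zero X h₂) φ List.mem_cons_self)
    -- `E` is an extension of `X` by `A⟦-1⟧`, whose phase `φ - 1` is below `c`.
    have hE' : σ.interval (Set.Iic c) E := .of_distTri hT.invRotate
      (.of _ ⟨φ - 1, by simp; linarith, σ.P_shift_neg_one hA⟩) hc
    intro ψ hψ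
    obtain rfl | hψ := List.mem_cons.1 hψ
    · exact key
    · exact ih hE' hE ψ hψ

theorem interval_split [IsTriangulated D] (X : D) (c : ℝ) : ∃ U V : D, DistTri U X V ∧
    σ.interval (Set.Ioi c) U ∧ σ.interval (Set.Iic c) V := by
  obtain ⟨l, hl⟩ := σ.exists_hnFiltered X
  obtain ⟨U, V, hT, hU, hV⟩ := hl.split c
  exact ⟨U, V, hT, hU.mono fun _ ⟨φ, _, hφ, hY⟩ => ⟨φ, hφ, hY⟩,
    hV.mono fun _ ⟨φ, _, hφ, hY⟩ => ⟨φ, hφ, hY⟩⟩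

/-- Charges add along triangles, and the sector of arguments in `(πb, πc]` is closed under addition.
-/
theorem isUpper_of_interval {X : D} {b c : ℝ} (hb : 0 ≤ b) (hc : c ≤ 1)
    (hX : σ.interval (Set.Ioc b c) X) :
    IsZero X ∨ (IsUpper (σ.Z (triCls X)) ∧ Real.pi * b < (σ.Z (triCls X)).arg ∧
      (σ.Z (triCls X)).arg ≤ Real.pi * c) := by
  refine ExtClosure.induction (R := fun X => IsZero X ∨ (IsUpper (σ.Z (triCls X)) ∧
    Real.pi * b < (σ.Z (triCls X)).arg ∧ (σ.Z (triCls X)).arg ≤ Real.pi * c)) ?_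
    (fun X hX => .inl hX) ?_ hX
  · rintro Y ⟨φ, hφ, hY⟩
    by_cases h₀ : IsZero Y
    · exact .inl h₀
    · obtain ⟨m, hm, h⟩ := σ.charge φ Y hY h₀
      have hφ' : φ ∈ Set.Ioc (0 : ℝ) 1 := ⟨hb.trans_lt hφ.1, hφ.2.trans hc⟩
      rw [h, arg_ray hm hφ']
      exact .inr ⟨isUpper_ray hm hφ', mul_lt_mul_of_pos_left hφ.1 Real.pi_pos,
        mul_le_mul_of_nonneg_left hφ.2 Real.pi_pos.le⟩
  · rintro X Y W hT hX hW
    obtain hX | ⟨hX, hX', hX''⟩ := hX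
    · obtain ⟨e⟩ := hT.iso_of_isZero₁ hX
      rw [triCls_iso e]
      exact hW.imp_left fun h => h.of_iso e
    · obtain hW | ⟨hW, hW', hW''⟩ := hW
      · obtain ⟨e⟩ := hT.iso_of_isZero₃ hW
        rw [← triCls_iso e]
        exact .inr ⟨hX, hX', hX''⟩
      · rw [hT.triCls, map_add]
        exact .inr ⟨hX.add hW, hX.lt_arg_add hW hX' hW', hX.arg_add_le hW hX'' hW''⟩

variable (σ)

/-- The t-structure of a stability condition, with heart `P((0, 1])`. -/
def tStructure [IsTriangulated D] : TStructure D where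
  -- The shift by `1` raises phases and lowers degrees, so degree `n` corresponds to phases in `(-n,
  -- 1 - n]`.
  le n := σ.interval (Set.Ioi (-n : ℝ))
  ge n := σ.interval (Set.Iic (1 - n : ℝ))
  le_isClosedUnderIsomorphisms _ := ⟨fun e hX => interval_iso hX e⟩
  ge_isClosedUnderIsomorphisms _ := ⟨fun e hX => interval_iso hX e⟩
  le_shift n a n' h X hX := interval_shift a (fun φ hφ => by
    subst h; simp only [Set.mem_Ioi] at *; push_cast at hφ; linarith) hX
  ge_shift n a n' h X hX := interval_shift a (fun φ hφ => by
    subst h; simp only [Set.mem_Iic] at *; push_cast at hφ; linarith) hX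
  zero' X Y f hX hY := interval_hom_eq_zero (fun φ hφ ψ hψ => by
    simp only [Set.mem_Iic, Set.mem_Ioi] at *; push_cast at hφ hψ; linarith) hX hY f
  le_zero_le X hX := interval_mono (fun φ hφ => by
    simp only [Set.mem_Ioi] at *; push_cast at *; linarith) hX
  ge_one_le X hX := interval_mono (fun φ hφ => by
    simp only [Set.mem_Iic] at *; push_cast at *; linarith) hX
  exists_triangle_zero_one X := by
    obtain ⟨U, V, ⟨f, g, h, hT⟩, hU, hV⟩ := interval_split (σ := σ) X 0
    exact ⟨U, V, by simpa using hU, by simpa using hV, f, g, h, hT⟩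

variable [IsTriangulated D]

theorem tStructure_bounded : IsBoundedTStructure σ.tStructure := by
  intro X
  obtain ⟨l, hl⟩ := σ.exists_hnFiltered X
  have h : ∃ N : ℕ, ∀ φ ∈ l, |φ| < N := by
    clear hl
    induction l with
    | nil => exact ⟨0, by simp⟩
    | cons φ l ih =>
      obtain ⟨N, hN⟩ := ih
      obtain ⟨M, hM⟩ := exists_nat_gt |φ|
      refine ⟨max M N, fun ψ hψ => ?_⟩
      push_cast
      obtain rfl | hψ := List.mem_cons.1 hψ
      · exact lt_max_of_lt_left hM
      · exact lt_max_of_lt_right (hN ψ hψ)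
  obtain ⟨N, hN⟩ := h
  refine ⟨-N, N, interval_of_hnFiltered hl fun φ hφ => ?_, interval_of_hnFiltered hl fun φ hφ => ?_⟩
  · have := abs_lt.1 (hN φ hφ)
    simp only [Set.mem_Iic]
    push_cast
    linarith
  · have := abs_lt.1 (hN φ hφ)
    simp only [Set.mem_Ioi]
    push_cast
    linarith

/-- Both bounds on an object of the heart hold for the phases of one and the same filtration, which
exhibits it in `P((0, 1])`. -/
theorem tStructure_heart : σ.tStructure.heart = σ.interval (Set.Ioc 0 1) := by
  ext X
  have e : σ.tStructure.heart X ↔ σ.interval (Set.Ioi 0) X ∧ σ.interval (Set.Iic 1) X := by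
    change σ.interval (Set.Ioi (-((0 : ℤ) : ℝ))) X ∧ σ.interval (Set.Iic (1 - ((0 : ℤ) : ℝ))) X ↔ _
    simp
  rw [e]
  refine ⟨fun ⟨h₁, h₂⟩ => ?_, fun h => ⟨interval_mono (fun _ h => h.1) h,
    interval_mono (fun _ h => h.2) h⟩⟩
  obtain ⟨l, hl⟩ := σ.exists_hnFiltered X
  exact interval_of_hnFiltered hl fun φ hφ =>
    ⟨lt_of_hnFiltered hl h₁ φ hφ, le_of_hnFiltered hl h₂ φ hφ⟩

variable {σ} in
theorem mem_Ioc_of_hnFiltered {l : List ℝ} {X : D} (hl : HNFiltered σ.P l X)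
    (hX : σ.tStructure.heart X) : ∀ φ ∈ l, φ ∈ Set.Ioc (0 : ℝ) 1 := by
  rw [tStructure_heart] at hX
  exact fun φ hφ => ⟨lt_of_hnFiltered hl (interval_mono (fun _ h => h.1) hX) φ hφ,
    le_of_hnFiltered hl (interval_mono (fun _ h => h.2) hX) φ hφ⟩

variable {σ} in
theorem heart_of_interval {I : Set ℝ} (hI : I ⊆ Set.Ioc 0 1) {X : D} (hX : σ.interval I X) :
    σ.tStructure.heart X := by
  rw [tStructure_heart]
  exact interval_mono hI hX

/-- The central charge of a stability condition restricted to the heart. -/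
noncomputable def heartZ : AbK₀ σ.tStructure.heart.FullSubcategory →+ ℂ :=
  σ.Z.comp (heartToTriK₀ σ.tStructure)

theorem heartZ_abCls (E : σ.tStructure.heart.FullSubcategory) :
    σ.heartZ (abCls E) = σ.Z (triCls E.obj) := by
  rw [heartZ, AddMonoidHom.comp_apply, heartToTriK₀_abCls]

variable {σ}

variable (σ) in
theorem heartZ_isStabilityFunction : IsStabilityFunction σ.heartZ := by
  rw [isStabilityFunction_iff]
  intro E hE
  rw [heartZ_abCls]
  have h : σ.interval (Set.Ioc 0 1) E.obj := σ.tStructure_heart ▸ E.property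
  exact ((isUpper_of_interval le_rfl le_rfl h).resolve_left
    fun h => hE ((heart_isZero_iff _).2 h)).1

theorem phase_mem_of_interval {E : σ.tStructure.heart.FullSubcategory} (hE : ¬ IsZero E) {b c : ℝ}
    (hb : 0 ≤ b) (hc : c ≤ 1) (h : σ.interval (Set.Ioc b c) E.obj) :
    phase σ.heartZ E ∈ Set.Ioc b c := by
  have := ((isUpper_of_interval hb hc h).resolve_left fun h => hE ((heart_isZero_iff _).2 h)).2
  rw [phase, heartZ_abCls, Set.mem_Ioc, div_le_iff₀ Real.pi_pos, lt_div_iff₀ Real.pi_pos,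
    mul_comm b, mul_comm c]
  exact this

theorem phase_eq_of_P {E : σ.tStructure.heart.FullSubcategory} (hE : ¬ IsZero E) {φ : ℝ}
    (hφ : φ ∈ Set.Ioc (0 : ℝ) 1) (h : σ.P φ E.obj) : phase σ.heartZ E = φ := by
  obtain ⟨m, hm, hZ⟩ := σ.charge φ E.obj h fun h => hE ((heart_isZero_iff _).2 h)
  exact phase_eq_of_charge hm hφ (by rw [heartZ_abCls, hZ])

/-- A subobject `F` splits in the heart into `U` of phases `> φ` and `V` of phases `≤ φ`. The
composite `U ⟶ F ⟶ E` is zero and also mono, so `U = 0` and `F ≅ V`. -/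
theorem isSemistable_of_P {E : σ.tStructure.heart.FullSubcategory} (hE : ¬ IsZero E) {φ : ℝ}
    (hφ : φ ∈ Set.Ioc (0 : ℝ) 1) (h : σ.P φ E.obj) : IsSemistable σ.heartZ E := by
  refine isSemistable_of_mono hE fun F i _ hF => ?_
  rw [phase_eq_of_P hE hφ h]
  obtain ⟨l, hl⟩ := σ.exists_hnFiltered F.obj
  have hl' := mem_Ioc_of_hnFiltered hl F.property
  obtain ⟨U, V, hT, hU, hV⟩ := hl.split φ
  have hU' : σ.interval (Set.Ioc φ 1) U := hU.mono fun _ ⟨ψ, hψ, hψ', hY⟩ =>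
    ⟨ψ, ⟨hψ', (hl' ψ hψ).2⟩, hY⟩
  have hV' : σ.interval (Set.Ioc 0 φ) V := hV.mono fun _ ⟨ψ, hψ, hψ', hY⟩ =>
    ⟨ψ, ⟨(hl' ψ hψ).1, hψ'⟩, hY⟩
  have hUh := heart_of_interval (Set.Ioc_subset_Ioc_left hφ.1.le) hU'
  have hVh := heart_of_interval (Set.Ioc_subset_Ioc_right hφ.2) hV'
  obtain ⟨f, g, w, hS⟩ := heart_shortExact σ.tStructure (X := ⟨U, hUh⟩)
    (Y := F) (Z := ⟨V, hVh⟩) hT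
  have h₀ : f ≫ i = 0 := ObjectProperty.hom_ext _
    (interval_hom_eq_zero (σ := σ) (J := {φ}) (by rintro ψ hψ _ rfl; exact hψ.1) hU'
      (.of _ ⟨φ, rfl, h⟩) _)
  have hf : f = 0 := by rwa [← cancel_mono i, Limits.zero_comp]
  have := hS.mono_f
  have hU₀ : IsZero U := by
    rw [← heart_isZero_iff σ.tStructure (X := ⟨U, hUh⟩)]
    exact IsZero.of_mono_eq_zero f hf
  obtain ⟨e⟩ := hT.iso_of_isZero₁ hU₀
  exact (phase_mem_of_interval hF le_rfl hφ.2 (interval_iso hV' e.symm)).2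

/-- Were the stage `E'` before the last factor `A` nonzero, its phase would exceed `φ`, whereas
semistability and the see-saw property give that it is at most the phase `φ` of `A`. -/
theorem P_of_isSemistable {E : σ.tStructure.heart.FullSubcategory} (hE : IsSemistable σ.heartZ E) :
    σ.P (phase σ.heartZ E) E.obj := by
  obtain ⟨l, hl⟩ := σ.exists_hnFiltered E.obj
  have hl' := mem_Ioc_of_hnFiltered hl E.property
  have hZ := σ.heartZ_isStabilityFunction
  cases hl with
  | nil _ h => exact absurd ((heart_isZero_iff _).2 h) hE.1
  | cons E' _ A φ l hT hA hA₀ hφ hE' =>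
    have hφ' := hl' φ List.mem_cons_self
    have hAh : σ.tStructure.heart A := heart_of_interval (I := {φ}) (by simpa using hφ')
      (.of A ⟨φ, rfl, hA⟩)
    have hEh : σ.tStructure.heart E' := heart_of_interval (I := Set.Ioc 0 1) (fun _ h => h)
      (interval_of_hnFiltered hE' fun ψ hψ => hl' ψ (List.mem_cons_of_mem _ hψ))
    have hA₁ : ¬ IsZero (⟨A, hAh⟩ : σ.tStructure.heart.FullSubcategory) := fun h =>
      hA₀ ((heart_isZero_iff _).1 h)
    have hAφ : phase σ.heartZ (⟨A, hAh⟩ : σ.tStructure.heart.FullSubcategory) = φ :=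
      phase_eq_of_P hA₁ hφ' hA
    by_cases h₀ : IsZero E'
    · obtain ⟨e⟩ := hT.iso_of_isZero₁ h₀
      have e' : E ≅ (⟨A, hAh⟩ : σ.tStructure.heart.FullSubcategory) := ObjectProperty.isoMk _ e
      rw [phase_iso e', hAφ]
      exact σ.P_iso hA e.symm
    · exfalso
      have h₁ : ¬ IsZero (⟨E', hEh⟩ : σ.tStructure.heart.FullSubcategory) := fun h =>
        h₀ ((heart_isZero_iff _).1 h)
      obtain ⟨f, g, w, hS⟩ := heart_shortExact σ.tStructure
        (X := ⟨E', hEh⟩) (Y := E) (Z := ⟨A, hAh⟩) hT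
      have := hS.mono_f
      have h₂ := (phase_left_le_mid_iff hZ hS h₁ hA₁).1 (hE.phase_le_of_mono f h₁)
      have h₃ := (phase_mem_of_interval (c := 1) h₁ hφ'.1.le le_rfl
        (interval_of_hnFiltered hE' fun ψ hψ =>
          ⟨hφ ψ hψ, (hl' ψ (List.mem_cons_of_mem _ hψ)).2⟩)).1
      dsimp only at h₂
      rw [hAφ] at h₂
      exact absurd h₃ (not_lt.2 h₂)

end StabilityCondition

end HeartOfStabilityCondition

/-! ### Harder–Narasimhan filtrations in an abelian category -/

theorem Subobject.exists_iso_of_eq_map {A : Type u} [Category.{v} A] [HasPullbacks A]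
    {E X : A} (f : E ⟶ X) [Mono f] {W : Subobject E}
    {Y : Subobject X} (h : Y = (Subobject.map f).obj W) :
    ∃ a : (W : A) ≅ (Y : A), a.hom ≫ Y.arrow = W.arrow ≫ f := by
  have h' : Y = Subobject.mk (W.arrow ≫ f) := by
    rw [h, ← Subobject.map_mk, Subobject.mk_arrow]
  subst h'
  exact ⟨(Subobject.underlyingIso _).symm, Subobject.underlyingIso_arrow _⟩

section AbelianFiltration

variable {A : Type u} [Category.{v} A] [Abelian A] {Z : AbK₀ A →+ ℂ}

/-- `E` has a Harder-Narasimhan filtration with phases in the given list. -/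
def HasHNFiltration (Z : AbK₀ A →+ ℂ) (l : List ℝ) (E : A) : Prop :=
  ∃ (n : ℕ) (F : Fin (n + 1) → Subobject E) (hF : Monotone F),
    F 0 = ⊥ ∧ F (Fin.last n) = ⊤ ∧ (∀ j : Fin n, IsSemistable Z (factor F hF j)) ∧
    StrictAnti (fun j : Fin n => phase Z (factor F hF j)) ∧
    ∀ j : Fin n, phase Z (factor F hF j) ∈ l

theorem Subobject.nonempty_iso_cokernel_ofLE {X E₁ E₂ : A} {X₁ X₂ : Subobject X} (h : X₁ ≤ X₂)
    (g : E₁ ⟶ E₂) (a₁ : E₁ ≅ (X₁ : A)) (a₂ : E₂ ≅ (X₂ : A))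
    (w : a₁.hom ≫ X₁.arrow = g ≫ a₂.hom ≫ X₂.arrow) :
    Nonempty (cokernel g ≅ cokernel (Subobject.ofLE X₁ X₂ h)) := by
  refine ⟨cokernel.mapIso _ _ a₁ a₂ ?_⟩
  rw [← cancel_mono X₂.arrow, Category.assoc, Category.assoc, Subobject.ofLE_arrow, w]

theorem HasHNFiltration.of_isZero {E : A} (hE : IsZero E) : HasHNFiltration Z [] E := by
  refine ⟨0, fun _ => ⊥, fun _ _ _ => le_rfl, rfl, ?_, fun j => j.elim0, fun j => j.elim0,
    fun j => j.elim0⟩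
  rw [← Subobject.isIso_arrow_iff_eq_top]
  have h : IsZero ((⊥ : Subobject E) : A) :=
    IsZero.of_mono_eq_zero (⊥ : Subobject E).arrow (hE.eq_of_tgt _ _)
  exact ⟨0, h.eq_of_src _ _, hE.eq_of_src _ _⟩

/-- The filtration of `S.X₁` is pushed forward along the monomorphism `S.f`, which preserves its
factors, and `⊤` is added as a last stage, with factor `S.X₃`. -/
theorem HasHNFiltration.cons {S : ShortComplex A} (hS : S.ShortExact) {l : List ℝ}
    (h : HasHNFiltration Z l S.X₁) (h₃ : IsSemistable Z S.X₃) {φ : ℝ} (hφ : phase Z S.X₃ = φ)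
    (hl : ∀ ψ ∈ l, φ < ψ) : HasHNFiltration Z (φ :: l) S.X₂ := by
  obtain ⟨n, F, hF, hF₀, hF₁, hss, hanti, hmem⟩ := h
  have := hS.mono_f
  have := hS.epi_g
  let G : Fin (n + 1 + 1) → Subobject S.X₂ :=
    Fin.snoc (α := fun _ => Subobject S.X₂) (fun k => (Subobject.map S.f).obj (F k)) ⊤
  have hG₁ (k : Fin (n + 1)) : G k.castSucc = (Subobject.map S.f).obj (F k) := by simp [G]
  have hG₂ : G (Fin.last (n + 1)) = ⊤ := by simp [G]
  have hG : Monotone G := by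
    rw [Fin.monotone_iff_le_succ]
    intro i
    induction i using Fin.lastCases with
    | last => rw [Fin.succ_last, hG₂]; exact le_top
    | cast i =>
      rw [← Fin.castSucc_succ, hG₁, hG₁]
      exact (Subobject.map S.f).monotone (hF Fin.castSucc_lt_succ.le)
  have e₁ (j : Fin n) : Nonempty (factor F hF j ≅ factor G hG j.castSucc) := by
    obtain ⟨a₁, ha₁⟩ := Subobject.exists_iso_of_eq_map S.f (hG₁ j.castSucc)
    obtain ⟨a₂, ha₂⟩ := Subobject.exists_iso_of_eq_map S.f (W := F j.succ)
      (Y := G j.castSucc.succ) (by rw [← Fin.castSucc_succ, hG₁])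
    refine Subobject.nonempty_iso_cokernel_ofLE _ _ a₁ a₂ ?_
    rw [ha₁, ha₂, Subobject.ofLE_arrow_assoc]
  have e₂ : Nonempty (S.X₃ ≅ factor G hG (Fin.last n)) := by
    obtain ⟨a₁, ha₁⟩ := Subobject.exists_iso_of_eq_map S.f (hG₁ (Fin.last n))
    have : IsIso (F (Fin.last n)).arrow := by rw [hF₁]; infer_instance
    have : IsIso (G (Fin.last n).succ).arrow := by rw [Fin.succ_last, hG₂]; infer_instance
    obtain ⟨e⟩ := Subobject.nonempty_iso_cokernel_ofLE (hG (Fin.castSucc_lt_succ (i := Fin.last n)).le)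
      S.f ((asIso (F (Fin.last n)).arrow).symm ≪≫ a₁) (asIso (G (Fin.last n).succ).arrow).symm
      (by simp [ha₁])
    exact ⟨(IsColimit.coconePointUniqueUpToIso hS.gIsCokernel (cokernelIsCokernel S.f)) ≪≫ e⟩
  obtain ⟨e₂⟩ := e₂
  have hlast : phase Z (factor G hG (Fin.last n)) = φ := by rw [← phase_iso e₂, hφ]
  have hcast (j : Fin n) : phase Z (factor G hG j.castSucc) = phase Z (factor F hF j) := by
    obtain ⟨e⟩ := e₁ j
    rw [phase_iso e]
  refine ⟨n + 1, G, hG, ?_, hG₂, fun j => ?_, ?_, fun j => ?_⟩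
  · rw [← Fin.castSucc_zero, hG₁, hF₀, Subobject.map_bot]
  · induction j using Fin.lastCases with
    | last => exact h₃.of_iso e₂
    | cast j =>
      obtain ⟨e⟩ := e₁ j
      exact (hss j).of_iso e
  · have : (fun j => phase Z (factor G hG j)) =
        Fin.snoc (α := fun _ => ℝ) (fun j => phase Z (factor F hF j)) φ := by
      funext j
      induction j using Fin.lastCases with
      | last => simpa using hlast
      | cast j => simpa using hcast j
    rw [this]
    exact Fin.strictAnti_snoc hanti fun j => hl _ (hmem j)
  · induction j using Fin.lastCases with
    | last => simp [hlast]
    | cast j => rw [hcast]; exact List.mem_cons_of_mem _ (hmem j)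

end AbelianFiltration

/-! ### The heart and stability function of a stability condition -/

section HeartOfStabilityCondition

variable {D : Type u} [Category.{v} D] [Preadditive D] [HasZeroObject D] [HasShift D ℤ]
  [∀ n : ℤ, (shiftFunctor D n).Additive] [Pretriangulated D] [IsTriangulated D]

namespace StabilityCondition

variable {σ : StabilityCondition D}

theorem hasHNFiltration_of_hnFiltered {l : List ℝ} {X : D} (hl : HNFiltered σ.P l X)
    (hX : σ.tStructure.heart X) (h : ∀ φ ∈ l, φ ∈ Set.Ioc (0 : ℝ) 1) :
    HasHNFiltration σ.heartZ l (⟨X, hX⟩ : σ.tStructure.heart.FullSubcategory) := by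
  induction hl with
  | nil X hX₀ => exact .of_isZero ((heart_isZero_iff _).2 hX₀)
  | cons E X A φ l hT hA hA₀ hφ hE ih =>
    have hφ' := h φ List.mem_cons_self
    have h' := fun ψ hψ => h ψ (List.mem_cons_of_mem _ hψ)
    have hAh : σ.tStructure.heart A := heart_of_interval (I := {φ}) (by simpa using hφ')
      (.of A ⟨φ, rfl, hA⟩)
    have hEh : σ.tStructure.heart E := heart_of_interval (I := Set.Ioc 0 1) (fun _ h => h)
      (interval_of_hnFiltered hE h')
    have hA₁ : ¬ IsZero (⟨A, hAh⟩ : σ.tStructure.heart.FullSubcategory) := fun h =>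
      hA₀ ((heart_isZero_iff _).1 h)
    obtain ⟨f, g, w, hS⟩ := heart_shortExact σ.tStructure (X := ⟨E, hEh⟩) (Y := ⟨X, hX⟩)
      (Z := ⟨A, hAh⟩) hT
    exact (ih hEh h').cons hS (isSemistable_of_P hA₁ hφ' hA) (phase_eq_of_P hA₁ hφ' hA) hφ

variable (σ) in
theorem heartZ_hasHNProperty : HasHNProperty σ.heartZ := by
  intro E _
  obtain ⟨l, hl⟩ := σ.exists_hnFiltered E.obj
  obtain ⟨n, F, hF, h₀, h₁, h₂, h₃, -⟩ :=
    hasHNFiltration_of_hnFiltered hl E.property (mem_Ioc_of_hnFiltered hl E.property)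
  exact ⟨n, F, hF, h₀, h₁, h₂, h₃⟩

variable (σ) in
/-- The heart and the stability function of a stability condition. -/
noncomputable def toHeartStability : HeartStability D where
  t := σ.tStructure
  bounded := σ.tStructure_bounded
  Z := σ.heartZ
  isStabilityFunction := σ.heartZ_isStabilityFunction
  hasHN := σ.heartZ_hasHNProperty

variable (σ) in
theorem toHeartStability_semistable {φ : ℝ} (hφ : φ ∈ Set.Ioc (0 : ℝ) 1) :
    σ.toHeartStability.semistable φ = σ.P φ := by
  ext X
  constructor
  · rintro (h₀ | ⟨hX, hss, rfl⟩)
    · exact σ.of_isZero φ X h₀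
    · exact P_of_isSemistable hss
  · intro h
    by_cases h₀ : IsZero X
    · exact .inl h₀
    · have hX : σ.tStructure.heart X := heart_of_interval (I := {φ}) (by simpa using hφ)
        (.of X ⟨φ, rfl, h⟩)
      have h₁ : ¬ IsZero (⟨X, hX⟩ : σ.tStructure.heart.FullSubcategory) := fun h =>
        h₀ ((heart_isZero_iff _).1 h)
      exact .inr ⟨hX, isSemistable_of_P h₁ hφ h, phase_eq_of_P h₁ hφ h⟩

end StabilityCondition

end HeartOfStabilityCondition

/-! ### The stability condition of a heart -/

section Slicing

variable {D : Type u} [Category.{v} D] [Preadditive D] [HasZeroObject D] [HasShift D ℤ]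
  [∀ n : ℤ, (shiftFunctor D n).Additive] [Pretriangulated D] [IsTriangulated D]

/-- The integer is `⌈φ⌉ - 1` and not `⌊φ⌋` because the interval is open on the left. -/
theorem sub_ceil_mem (φ : ℝ) : φ - ((⌈φ⌉ - 1 : ℤ) : ℝ) ∈ Set.Ioc (0 : ℝ) 1 := by
  have h₁ := Int.ceil_lt_add_one φ
  have h₂ := Int.le_ceil φ
  constructor <;> push_cast <;> linarith

theorem exists_eq_add_int (φ : ℝ) : ∃ ψ ∈ Set.Ioc (0 : ℝ) 1, ∃ n : ℤ, φ = ψ + n :=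
  ⟨_, sub_ceil_mem φ, _, (sub_add_cancel _ _).symm⟩

/-- The composition of two shifts. -/
def shiftAddIso (X : D) (a b c : ℤ) (h : a + b = c) : X⟦c⟧ ≅ X⟦a⟧⟦b⟧ :=
  (shiftFunctorAdd' D a b c h).app X

namespace HeartStability

variable (h : HeartStability D)

theorem semistable_iso {φ : ℝ} {X Y : D} (hX : h.semistable φ X) (e : X ≅ Y) :
    h.semistable φ Y := by
  obtain hX | ⟨hX, hss, hφ⟩ := hX
  · exact .inl (hX.of_iso e.symm)
  · have hY : h.t.heart Y := h.t.heart.prop_of_iso e hX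
    have e' : (⟨X, hX⟩ : h.t.heart.FullSubcategory) ≅ ⟨Y, hY⟩ := ObjectProperty.isoMk _ e
    exact .inr ⟨hY, hss.of_iso e', by rw [← phase_iso e', hφ]⟩

theorem semistable_heart {φ : ℝ} {X : D} (hX : h.semistable φ X) : h.t.heart X := by
  obtain hX | ⟨hX, -⟩ := hX
  · exact (h.t.mem_heart_iff _).2 ⟨h.t.isLE_of_isZero hX 0, h.t.isGE_of_isZero hX 0⟩
  · exact hX

theorem semistable_of_distTri {φ : ℝ} {X Y Z : D} (hT : DistTri X Y Z) (hX : h.semistable φ X)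
    (hZ : h.semistable φ Z) : h.semistable φ Y := by
  obtain hX | ⟨hX, hss, hφ⟩ := hX
  · obtain ⟨e⟩ := hT.iso_of_isZero₁ hX
    exact h.semistable_iso hZ e.symm
  obtain hZ | ⟨hZ, hss', hφ'⟩ := hZ
  · obtain ⟨e⟩ := hT.iso_of_isZero₃ hZ
    exact h.semistable_iso (.inr ⟨hX, hss, hφ⟩) e
  have h₁ := (h.t.mem_heart_iff _).1 hX
  have h₃ := (h.t.mem_heart_iff _).1 hZ
  have hY : h.t.heart Y := (h.t.mem_heart_iff _).2
    ⟨hT.isLE₂ h.t 0 h₁.1 h₃.1, hT.isGE₂ h.t 0 h₁.2 h₃.2⟩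
  obtain ⟨f, g, w, hS⟩ := heart_shortExact h.t (X := ⟨X, hX⟩) (Y := ⟨Y, hY⟩) (Z := ⟨Z, hZ⟩) hT
  exact .inr ⟨hY, IsSemistable.of_shortExact h.isStabilityFunction hS hss hss' hφ hφ'⟩

theorem semistable_hom_eq_zero {φ ψ : ℝ} (hlt : ψ < φ) {X Y : D} (hX : h.semistable φ X)
    (hY : h.semistable ψ Y) (f : X ⟶ Y) : f = 0 := by
  obtain hX | ⟨hX, hss, hφ⟩ := hX
  · exact hX.eq_of_src _ _
  obtain hY | ⟨hY, hss', hφ'⟩ := hY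
  · exact hY.eq_of_tgt _ _
  exact congrArg (fun g => g.hom) (hss.hom_eq_zero h.isStabilityFunction hss' (by rwa [hφ, hφ'])
    (ObjectProperty.homMk f))

/-- The slicing of a heart with a stability function: `P(ψ + n) = P(ψ)[n]` for `ψ ∈ (0, 1]`. -/
def slice (φ : ℝ) : ObjectProperty D :=
  fun X => h.semistable (φ - ((⌈φ⌉ - 1 : ℤ) : ℝ)) (X⟦-(⌈φ⌉ - 1)⟧)

theorem slice_add_iff {ψ : ℝ} (hψ : ψ ∈ Set.Ioc (0 : ℝ) 1) (n : ℤ) (X : D) :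
    h.slice (ψ + n) X ↔ h.semistable ψ (X⟦-n⟧) := by
  have : ⌈ψ⌉ = 1 := Int.ceil_eq_iff.2 ⟨by simpa using hψ.1, by simpa using hψ.2⟩
  have e : ⌈ψ + n⌉ - 1 = n := by rw [Int.ceil_add_intCast, this]; ring
  rw [slice, e, add_sub_cancel_right]

theorem slice_iso {φ : ℝ} {X Y : D} (hX : h.slice φ X) (e : X ≅ Y) : h.slice φ Y :=
  h.semistable_iso hX ((shiftFunctor D _).mapIso e)

theorem slice_iff_semistable {ψ : ℝ} (hψ : ψ ∈ Set.Ioc (0 : ℝ) 1) (X : D) :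
    h.slice ψ X ↔ h.semistable ψ X := by
  have := h.slice_add_iff hψ 0 X
  rw [Int.cast_zero, add_zero] at this
  rw [this]
  have e : X⟦(-0 : ℤ)⟧ ≅ X := (shiftFunctorZero' D (-0 : ℤ) neg_zero).app X
  exact ⟨fun h' => h.semistable_iso h' e, fun h' => h.semistable_iso h' e.symm⟩

theorem slice_add_int_iff (φ : ℝ) (m : ℤ) (X : D) : h.slice (φ + m) X ↔ h.slice φ (X⟦-m⟧) := by
  obtain ⟨ψ, hψ, n, rfl⟩ := exists_eq_add_int φ
  rw [add_assoc, ← Int.cast_add, h.slice_add_iff hψ, h.slice_add_iff hψ]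
  have e := shiftAddIso X (-m) (-n) (-(n + m)) (by ring)
  exact ⟨fun h' => h.semistable_iso h' e, fun h' => h.semistable_iso h' e.symm⟩

theorem slice_shift {φ : ℝ} {X : D} (hX : h.slice φ X) (n : ℤ) : h.slice (φ + n) (X⟦n⟧) := by
  rw [slice_add_int_iff]
  exact h.slice_iso hX ((shiftEquiv D n).unitIso.app X)

theorem slice_add_int_eq_map (φ : ℝ) (n : ℤ) :
    h.slice (φ + n) = (h.slice φ).map (shiftFunctor D n) := by
  ext X
  constructor
  · intro hX
    exact ⟨X⟦-n⟧, (h.slice_add_int_iff φ n X).1 hX, ⟨(shiftEquiv D n).counitIso.app X⟩⟩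
  · rintro ⟨Y, hY, ⟨e⟩⟩
    exact h.slice_iso (h.slice_shift hY n) e

theorem slice_of_isZero (φ : ℝ) {X : D} (hX : IsZero X) : h.slice φ X :=
  .inl (Functor.map_isZero (shiftFunctor D _) hX)

theorem slice_of_distTri {φ : ℝ} {X Y Z : D} (hT : DistTri X Y Z) (hX : h.slice φ X)
    (hZ : h.slice φ Z) : h.slice φ Y :=
  h.semistable_of_distTri (hT.shift _) hX hZ

theorem isLE_of_slice {ψ : ℝ} (hψ : ψ ∈ Set.Ioc (0 : ℝ) 1) {n : ℤ} {X : D}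
    (hX : h.slice (ψ + n) X) : h.t.IsLE X (-n) := by
  have := ((h.t.mem_heart_iff _).1 (h.semistable_heart ((h.slice_add_iff hψ n X).1 hX))).1
  exact h.t.isLE_of_shift X (-n) (-n) 0

theorem isGE_of_slice {ψ : ℝ} (hψ : ψ ∈ Set.Ioc (0 : ℝ) 1) {n : ℤ} {X : D}
    (hX : h.slice (ψ + n) X) : h.t.IsGE X (-n) := by
  have := ((h.t.mem_heart_iff _).1 (h.semistable_heart ((h.slice_add_iff hψ n X).1 hX))).2
  exact h.t.isGE_of_shift X (-n) (-n) 0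

/-- For different integer parts the t-structure kills the map; for equal ones it is a shift of a map
between semistable objects of the heart. -/
theorem slice_hom_eq_zero {φ₁ φ₂ : ℝ} (hlt : φ₂ < φ₁) {X Y : D} (hX : h.slice φ₁ X)
    (hY : h.slice φ₂ Y) (f : X ⟶ Y) : f = 0 := by
  obtain ⟨ψ₁, hψ₁, n₁, rfl⟩ := exists_eq_add_int φ₁
  obtain ⟨ψ₂, hψ₂, n₂, rfl⟩ := exists_eq_add_int φ₂
  have hn : n₂ ≤ n₁ := by
    by_contra hn
    have : (n₁ : ℝ) + 1 ≤ n₂ := by exact_mod_cast not_le.1 hn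
    linarith [hψ₁.2, hψ₂.1]
  obtain hn | rfl := hn.lt_or_eq
  · exact h.t.zero_of_isLE_of_isGE f (-n₁) (-n₂) (by lia) (h.isLE_of_slice hψ₁ hX)
      (h.isGE_of_slice hψ₂ hY)
  · apply (shiftFunctor D (-n₂)).map_injective
    rw [Functor.map_zero]
    exact h.semistable_hom_eq_zero (by linarith) ((h.slice_add_iff hψ₁ _ _).1 hX)
      ((h.slice_add_iff hψ₂ _ _).1 hY) _

/-- The central charge on the triangulated category. -/
noncomputable def charge : TriK₀ D →+ ℂ :=
  h.Z.comp (heartK₀Equiv h.bounded).symm.toAddMonoidHom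

theorem charge_triCls (E : h.t.heart.FullSubcategory) : h.charge (triCls E.obj) = h.Z (abCls E) := by
  rw [← heartK₀Equiv_abCls h.bounded]
  simp [charge]

theorem exp_add_int (ψ : ℝ) (n : ℤ) : Complex.exp (Complex.I * Real.pi * ((ψ + n : ℝ) : ℂ)) =
    ((n.negOnePow : ℤ) : ℂ) * Complex.exp (Complex.I * Real.pi * ψ) := by
  have : Complex.I * Real.pi * ((ψ + n : ℝ) : ℂ) =
      n * (Real.pi * Complex.I) + Complex.I * Real.pi * ψ := by
    push_cast
    ring
  rw [this, Complex.exp_add, Complex.exp_int_mul, Complex.exp_pi_mul_I]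
  congr 1
  rw [Int.negOnePow_def]
  obtain h | h := Int.even_or_odd n
  · simp [h.neg_one_zpow]
  · simp [h.neg_one_zpow]

/-- The shift by `n` multiplies the class, and the exponential, by the same sign `(-1)^n`. -/
theorem charge_slice {φ : ℝ} {E : D} (hE : h.slice φ E) (h₀ : ¬ IsZero E) :
    ∃ m : ℝ, 0 < m ∧ h.charge (triCls E) = (m : ℂ) * Complex.exp (Complex.I * Real.pi * φ) := by
  obtain ⟨ψ, hψ, n, rfl⟩ := exists_eq_add_int φ
  obtain hE | ⟨hE, hss, hφ⟩ := (h.slice_add_iff hψ n E).1 hE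
  · exact absurd (isZero_of_shift _ hE) h₀
  obtain ⟨m, hm, hZ⟩ := charge_eq h.isStabilityFunction hss.1
  refine ⟨m, hm, ?_⟩
  rw [← h.charge_triCls, hφ] at hZ
  have hs : triCls E = n.negOnePow • triCls (E⟦-n⟧) := by
    rw [triCls_shift, Int.negOnePow_neg, smul_smul, Int.units_mul_self, one_smul]
  rw [exp_add_int, mul_left_comm, ← hZ, hs]
  obtain e | e := Int.units_eq_one_or n.negOnePow
  · simp [e]
  · simp [e, Units.neg_smul]

theorem exists_hnFiltered_heart (E : h.t.heart.FullSubcategory) :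
    ∃ l, HNFiltered h.slice l E.obj ∧ ∀ φ ∈ l, φ ∈ Set.Ioc (0 : ℝ) 1 := by
  by_cases h₀ : IsZero E
  · exact ⟨[], .nil _ ((heart_isZero_iff _).1 h₀), by simp⟩
  obtain ⟨n, F, hF, hF₀, hF₁, hss, hanti⟩ := h.hasHN E h₀
  -- Recording the indices from which the phases come lets `hanti` show that each new phase is
  -- smaller.
  have key : ∀ k : Fin (n + 1), ∃ l, HNFiltered h.slice l (F k : h.t.heart.FullSubcategory).obj ∧
      ∀ ψ ∈ l, ∃ j : Fin n, j.castSucc < k ∧ ψ = phase h.Z (factor F hF j) := by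
    intro k
    induction k using Fin.induction with
    | zero =>
      refine ⟨[], .nil _ ((heart_isZero_iff _).1 ?_), by simp⟩
      rw [hF₀]
      exact (isZero_zero _).of_iso Subobject.botCoeIsoZero
    | succ j ih =>
      obtain ⟨l, hl, hl'⟩ := ih
      have hS := shortExact_of_mono (Subobject.ofLE (F j.castSucc) (F j.succ)
        (hF (Fin.castSucc_lt_succ (i := j)).le))
      have hψ := phase_mem h.isStabilityFunction (hss j).1
      obtain ⟨l', hl₁, hl₂⟩ := hl.extend (heart_distTri h.t hS)
        ((h.slice_iff_semistable hψ _).2 (.inr ⟨(factor F hF j).property, hss j, rfl⟩))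
        fun ψ hψ => by
          obtain ⟨i, hi, rfl⟩ := hl' ψ hψ
          exact hanti (Fin.castSucc_lt_castSucc_iff.1 hi)
      refine ⟨l', hl₁, fun ψ hψ => ?_⟩
      obtain rfl | hψ := hl₂ ψ hψ
      · exact ⟨j, Fin.castSucc_lt_succ, rfl⟩
      · obtain ⟨i, hi, rfl⟩ := hl' ψ hψ
        exact ⟨i, hi.trans Fin.castSucc_lt_succ, rfl⟩
  obtain ⟨l, hl, hl'⟩ := key (Fin.last n)
  have : IsIso (F (Fin.last n)).arrow := by rw [hF₁]; infer_instance
  refine ⟨l, hl.of_iso (h.t.heart.ι.mapIso (asIso (F (Fin.last n)).arrow)), fun φ hφ => ?_⟩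
  obtain ⟨j, -, rfl⟩ := hl' φ hφ
  exact phase_mem h.isStabilityFunction (hss j).1

theorem hnFiltered_shift {l : List ℝ} {X : D} (hX : HNFiltered h.slice l X) (n : ℤ) :
    HNFiltered h.slice (l.map (· + (n : ℝ))) (X⟦n⟧) := by
  induction hX with
  | nil X hX => exact .nil _ (Functor.map_isZero (shiftFunctor D n) hX)
  | cons E X A φ l hT hA hA₀ hφ hE ih =>
    refine .cons _ _ _ _ _ (hT.shift n) (h.slice_shift hA n) (fun h' => hA₀ (isZero_of_shift n h'))
      (fun ψ hψ => ?_) ih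
    obtain ⟨ψ, hψ', rfl⟩ := List.mem_map.1 hψ
    exact add_lt_add_left (hφ ψ hψ') _

/-- By induction `U⟦-1⟧` has positive phases, so `U` has phases `> 1`, while the top cohomology `H`
has phases in `(0, 1]`; the two filtrations can be concatenated. -/
theorem exists_hnFiltered_of_isLE (X : D) (n : ℕ) (hX : h.t.IsLE X 0)
    (hX' : h.t.IsGE X (1 - n)) : ∃ l, HNFiltered h.slice l X ∧ ∀ φ ∈ l, 0 < φ := by
  induction n generalizing X with
  | zero => exact ⟨[], .nil _ (h.t.isZero X 0 (1 - (0 : ℕ)) (by lia)), by simp⟩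
  | succ n ih =>
    obtain ⟨U, H, hU, hH, hT⟩ := exists_distTri_heart h.t X hX
    have hH' := ((h.t.mem_heart_iff _).1 hH).2
    have := hT.isGE₁ h.t _ hX' (h.t.isGE_of_ge H _ 0)
    obtain ⟨l, hl, hl'⟩ := ih (U⟦(-1 : ℤ)⟧) (h.t.isLE_shift U (-1) (-1) 0)
      (h.t.isGE_shift U (1 - (n + 1 : ℕ)) (-1) (1 - n))
    obtain ⟨l₁, hl₁, hl₁'⟩ := h.exists_hnFiltered_heart ⟨H, hH⟩
    have hlU := (h.hnFiltered_shift hl 1).of_iso ((shiftEquiv D (1 : ℤ)).counitIso.app U)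
    refine ⟨_, .append hT hlU hl₁ fun φ hφ ψ hψ => ?_, fun φ hφ => ?_⟩
    · obtain ⟨ψ, hψ', rfl⟩ := List.mem_map.1 hψ
      have h₁ := (hl₁' φ hφ).2
      have h₂ := hl' ψ hψ'
      push_cast
      linarith
    · obtain hφ | hφ := List.mem_append.1 hφ
      · exact (hl₁' φ hφ).1
      · obtain ⟨ψ, hψ, rfl⟩ := List.mem_map.1 hφ
        have h₂ := hl' ψ hψ
        push_cast
        linarith

theorem exists_hnFiltered (X : D) : ∃ l, HNFiltered h.slice l X := by
  obtain ⟨a, b, ha, hb⟩ := h.bounded X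
  have ha : h.t.IsGE X a := ⟨ha⟩
  have hb : h.t.IsLE X b := ⟨hb⟩
  have h₁ := h.t.isGE_of_ge X (1 - ((1 + b - a).toNat : ℤ) + b) a
  obtain ⟨l, hl, -⟩ := h.exists_hnFiltered_of_isLE (X⟦b⟧) (1 + b - a).toNat (h.t.isLE_shift X b b 0)
    (h.t.isGE_shift X (1 - ((1 + b - a).toNat : ℤ) + b) b _ (by lia))
  exact ⟨_, (h.hnFiltered_shift hl (-b)).of_iso ((shiftEquiv D b).unitIso.symm.app X)⟩

/-- The stability condition of a heart with a stability function. -/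
noncomputable def toStabilityCondition : StabilityCondition D where
  Z := h.charge
  P := h.slice
  of_iso φ X Y := fun ⟨e⟩ hX => h.slice_iso hX e
  of_isZero φ X hX := h.slice_of_isZero φ hX
  biprod φ X Y hX hY := h.slice_of_distTri (.biprod X Y) hX hY
  charge φ E hE h₀ := h.charge_slice hE h₀
  shift φ := by simpa using h.slice_add_int_eq_map φ 1
  hom_eq_zero φ₁ φ₂ hlt A₁ A₂ h₁ h₂ f := h.slice_hom_eq_zero hlt h₁ h₂ f
  exists_tower E _ := by
    obtain ⟨l, hl⟩ := h.exists_hnFiltered E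
    obtain ⟨T, -⟩ := hl.exists_tower
    exact ⟨T⟩

end HeartStability

end Slicing

/-! ### The two constructions are mutually inverse -/

section Equivalence

variable {D : Type u} [Category.{v} D] [Preadditive D] [HasZeroObject D] [HasShift D ℤ]
  [∀ n : ℤ, (shiftFunctor D n).Additive] [Pretriangulated D]

/-- Each half is the orthogonal of the other, so enlarging one shrinks the other; the two inclusions
must be equalities. -/
theorem tStructure_ext_of_le {t₁ t₂ : TStructure D} (hle : ∀ n X, t₁.le n X → t₂.le n X)
    (hge : ∀ n X, t₁.ge n X → t₂.ge n X) : t₁ = t₂ := by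
  have h₁ : t₁.le = t₂.le := by
    ext n X
    refine ⟨hle n X, fun hX => ?_⟩
    have : t₂.IsLE X n := ⟨hX⟩
    suffices t₁.IsLE X n from this.le
    rw [t₁.isLE_iff_orthogonal n (n + 1) rfl]
    intro Y f hY
    exact t₂.zero_of_isLE_of_isGE f n (n + 1) (by lia) ⟨hX⟩ ⟨hge _ _ hY.ge⟩
  have h₂ : t₁.ge = t₂.ge := by
    ext n X
    refine ⟨hge n X, fun hX => ?_⟩
    suffices t₁.IsGE X n from this.ge
    rw [t₁.isGE_iff_orthogonal (n - 1) n (by lia)]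
    intro Y f hY
    exact t₂.zero_of_isLE_of_isGE f (n - 1) n (by lia) ⟨hle _ _ hY.le⟩ ⟨hX⟩
  cases t₁
  cases t₂
  congr

variable [IsTriangulated D]

/-- The types of the two charges depend on the t-structures, so the charges are compared on objects
of `D`. -/
theorem heartStability_ext {h₁ h₂ : HeartStability D} (ht : h₁.t = h₂.t)
    (hZ : ∀ (X : D) (hX₁ : h₁.t.heart X) (hX₂ : h₂.t.heart X),
      h₁.Z (abCls ⟨X, hX₁⟩) = h₂.Z (abCls ⟨X, hX₂⟩)) : h₁ = h₂ := by
  obtain ⟨t, _, Z₁, _, _⟩ := h₁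
  obtain ⟨_, _, Z₂, _, _⟩ := h₂
  obtain rfl : t = _ := ht
  obtain rfl : Z₁ = Z₂ := abK₀_hom_ext fun E => hZ E.obj E.property E.property
  rfl

/-- It suffices to place the generators: an object of phase `ψ + m` with `ψ ∈ (0, 1]` is
concentrated in degree `-m`. -/
theorem HeartStability.tStructure_toStabilityCondition (h : HeartStability D) :
    h.toStabilityCondition.tStructure = h.t := by
  apply tStructure_ext_of_le
  · intro n X hX
    refine ExtClosure.induction (R := h.t.le n) ?_ (fun Y hY => (h.t.isLE_of_isZero hY n).le)
      (fun _ _ _ hT h₁ h₃ => (hT.isLE₂ h.t n ⟨h₁⟩ ⟨h₃⟩).le) hX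
    rintro Y ⟨φ, hφ, hY⟩
    obtain ⟨ψ, hψ, m, rfl⟩ := exists_eq_add_int φ
    have := h.isLE_of_slice hψ hY
    have hmn : -m ≤ n := by
      have h₁ : -(n : ℝ) < ψ + m := hφ
      have h₂ : ((-m : ℤ) : ℝ) < ((n + 1 : ℤ) : ℝ) := by push_cast; linarith [hψ.2]
      have := Int.cast_lt.1 h₂
      lia
    exact (h.t.isLE_of_le Y (-m) n).le
  · intro n X hX
    refine ExtClosure.induction (R := h.t.ge n) ?_ (fun Y hY => (h.t.isGE_of_isZero hY n).ge)
      (fun _ _ _ hT h₁ h₃ => (hT.isGE₂ h.t n ⟨h₁⟩ ⟨h₃⟩).ge) hX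
    rintro Y ⟨φ, hφ, hY⟩
    obtain ⟨ψ, hψ, m, rfl⟩ := exists_eq_add_int φ
    have := h.isGE_of_slice hψ hY
    have hmn : n ≤ -m := by
      have h₁ : ψ + m ≤ 1 - (n : ℝ) := hφ
      have h₂ : ((n - 1 : ℤ) : ℝ) < ((-m : ℤ) : ℝ) := by push_cast; linarith [hψ.1]
      have := Int.cast_lt.1 h₂
      lia
    exact (h.t.isGE_of_ge Y n (-m)).ge

theorem HeartStability.toHeartStability_toStabilityCondition (h : HeartStability D) :
    h.toStabilityCondition.toHeartStability = h := by
  refine heartStability_ext h.tStructure_toStabilityCondition fun X hX₁ hX₂ => ?_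
  exact (h.toStabilityCondition.heartZ_abCls ⟨X, hX₁⟩).trans (h.charge_triCls ⟨X, hX₂⟩)

theorem StabilityCondition.toStabilityCondition_toHeartStability (σ : StabilityCondition D) :
    σ.toHeartStability.toStabilityCondition = σ := by
  ext1
  · change σ.toHeartStability.charge = σ.Z
    -- Precomposing with the isomorphism from the Grothendieck group of the heart reduces the
    -- comparison to classes of heart objects.
    have : σ.toHeartStability.charge.comp
        (heartK₀Equiv σ.tStructure_bounded).toAddMonoidHom =
        σ.Z.comp (heartK₀Equiv σ.tStructure_bounded).toAddMonoidHom := abK₀_hom_ext fun E => by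
      change σ.toHeartStability.charge (heartK₀Equiv σ.tStructure_bounded (abCls E)) =
        σ.Z (heartK₀Equiv σ.tStructure_bounded (abCls E))
      rw [heartK₀Equiv_abCls]
      exact (σ.toHeartStability.charge_triCls E).trans (σ.heartZ_abCls E)
    exact (AddMonoidHom.cancel_right (heartK₀Equiv σ.tStructure_bounded).surjective).1 this
  · funext φ X
    obtain ⟨ψ, hψ, n, rfl⟩ := exists_eq_add_int φ
    apply propext
    refine (σ.toHeartStability.slice_add_iff hψ n X).trans ?_
    rw [σ.toHeartStability_semistable hψ, ← σ.P_shift_iff (-n) (φ := ψ + n)]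
    simp

/-- The bijection between stability conditions and hearts with a stability function. -/
noncomputable def stabilityConditionEquiv : StabilityCondition D ≃ HeartStability D where
  toFun σ := σ.toHeartStability
  invFun h := h.toStabilityCondition
  left_inv σ := σ.toStabilityCondition_toHeartStability
  right_inv h := h.toHeartStability_toStabilityCondition

end Equivalence

end BridgelandStability

theorem proposition5 (D : Type u) [Category.{v} D] [Preadditive D] [HasZeroObject D]
    [HasShift D ℤ] [∀ n : ℤ, (shiftFunctor D n).Additive] [Pretriangulated D]
    [IsTriangulated D] :
    (∀ t : TStructure D, IsBoundedTStructure t →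
      ∃ κ : AbK₀ t.heart.FullSubcategory ≃+ TriK₀ D,
        ∀ E : t.heart.FullSubcategory, κ (abCls E) = triCls E.obj) ∧
    ∃ e : StabilityCondition D ≃ HeartStability D,
      (∀ σ : StabilityCondition D,
        (e σ).t.heart = σ.interval (Set.Ioc 0 1) ∧
        ∀ E : (e σ).t.heart.FullSubcategory, (e σ).Z (abCls E) = σ.Z (triCls E.obj)) ∧
      (∀ h : HeartStability D,
        (∀ E : h.t.heart.FullSubcategory, (e.symm h).Z (triCls E.obj) = h.Z (abCls E)) ∧
        (∀ φ ∈ Set.Ioc (0 : ℝ) 1, (e.symm h).P φ = h.semistable φ) ∧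
        (∀ φ ∈ Set.Ioc (0 : ℝ) 1, ∀ n : ℤ,
          (e.symm h).P (φ + n) = (h.semistable φ).map (shiftFunctor D n))) := by
  have hP (h : HeartStability D) (φ : ℝ) (hφ : φ ∈ Set.Ioc (0 : ℝ) 1) :
      h.slice φ = h.semistable φ := by
    ext X
    exact h.slice_iff_semistable hφ X
  refine ⟨fun t ht => ⟨heartK₀Equiv ht, heartK₀Equiv_abCls ht⟩, stabilityConditionEquiv,
    fun σ => ⟨σ.tStructure_heart, σ.heartZ_abCls⟩, fun h => ⟨h.charge_triCls, hP h,
      fun φ hφ n => ?_⟩⟩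
  rw [← hP h φ hφ]
  exact h.slice_add_int_eq_map φ n
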